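/- A metrized graph $\Gamma$ is a finite connected graph (multiple edges and self-loops allowed) with vertex set $V$ and edge set $E$, in which each edge $e$ is identified with a segment of length $L_e>0$; its total length is $\ell(\Gamma)=\sum_{e\in E}L_e$. For $y,z\in\Gamma$ let $x\mapsto j_z(x,y)$ be the voltage function, i.e. the continuous function on $\Gamma$ with $j_z(z,y)=0$ and $\Delta_x\, j_z(x,y)=\delta_y-\delta_z$, where $\Delta f=-f''\,dx-\sum_p\big(\sum_{\vec v\text{ at }p}d_{\vec v}f(p)\big)\delta_p$, and let $r(x,y)=j_x(y,y)$ be the effective resistance. The tau constant $\tau(\Gamma)$ is defined as follows: there is a real-valued signed Borel measure $\mu$ on $\Gamma$ with $\mu(\Gamma)=1$ such that $\int_\Gamma j_\zeta(x,x)\,d\mu(\zeta)$ does not depend on $x\in\Gamma$, and $\tau(\Gamma)$ is one half of this constant value, which is the same for every such $\mu$. For an edge $e$ with end points $p,q$, let $R_e\in[0,\infty]$ be the effective resistance between $p$ and $q$ in $\Gamma-e$ (the graph with the interior of $e$ removed) if $\Gamma-e$ is connected, and $R_e=\infty$ otherwise. Theorem. The tau constant is well defined, and: (1) If $\ell(\Gamma)=1$,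 then $$\tau(\Gamma)\ \ge\ \frac{1}{12}\,\frac{1}{\big(1+\sum_{e\in E}R_e\big)^2},$$ where the right-hand side is $0$ if some $R_e=\infty$. (2) If $\ell(\Gamma)=1$ and any two distinct vertices that are the end points of an edge are joined by at least two edges, then $\tau(\Gamma)\ge\frac1{48}$. (3) Consequently the lower bound conjecture of Baker and Rumely holds for that class of graphs with the constant $C=\frac1{48}$: if any two distinct vertices of $\Gamma$ that are the end points of an edge are joined by at least two edges, then $\tau(\Gamma)\ge\frac1{48}\,\ell(\Gamma)$, whatever the total length. -/

import Mathlib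

open Set Filter Topology MeasureTheory
open scoped ENNReal

/-- Combinatorial data of a finite graph each of whose edges has a distinguished parametrization:
`V` is the vertex set, `E` the edge set, and the edge `e` is a copy of the segment `[0, len e]`
with `0` glued to the vertex `src e` and `len e` glued to the vertex `tgt e`.
Multiple edges and self-loops are allowed. Connectedness, which is part of the notion of a
metrized graph, is the separate predicate `MetrizedGraph.Connected`, since deleting an edge
can destroy it. -/
structure MetrizedGraph (V E : Type*) where
  src : E → V
  tgt : E → V
  len : E → ℝ
  len_pos : ∀ e, 0 < len e

namespace MetrizedGraph

variable {V E : Type*} (Γ : MetrizedGraph V E)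

/-- The graph is non-empty and any two vertices are joined by a chain of edges. -/
def Connected : Prop :=
  (SimpleGraph.fromRel fun u v => ∃ e, Γ.src e = u ∧ Γ.tgt e = v).Connected

/-- The total length `ℓ(Γ)`. -/
def totalLength [Fintype E] : ℝ := ∑ e, Γ.len e

/-- The two edges have the same unordered pair of end points. -/
def Parallel (e e' : E) : Prop :=
  (Γ.src e' = Γ.src e ∧ Γ.tgt e' = Γ.tgt e) ∨ (Γ.src e' = Γ.tgt e ∧ Γ.tgt e' = Γ.src e)

/-- Any two distinct vertices that are the end points of an edge are joined by at least two
edges. -/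
def AdjacentMultiplyJoined : Prop :=
  ∀ e, Γ.src e ≠ Γ.tgt e → ∃ e', e' ≠ e ∧ Γ.Parallel e e'

/-- The graph `Γ - e` obtained by removing the interior of the edge `e`; the vertex set stays
the same. -/
def deleteEdge (e : E) : MetrizedGraph V {e' : E // e' ≠ e} where
  src e' := Γ.src e'
  tgt e' := Γ.tgt e'
  len e' := Γ.len e'
  len_pos e' := Γ.len_pos e'

/-- The points of the metrized graph: the vertices and the interior points of the edges. -/
inductive Point (Γ : MetrizedGraph V E) : Type _
  | vertex (v : V) : Point Γ
  | interior (e : E) (t : ℝ) (ht : t ∈ Ioo 0 (Γ.len e)) : Point Γ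

open Classical in
/-- The parametrization of the edge `e` by `[0, len e]`, extended to `ℝ` as a constant on either
side. -/
noncomputable def point (e : E) (t : ℝ) : Γ.Point :=
  if ht : t ∈ Ioo 0 (Γ.len e) then Point.interior e t ht
  else if t ≤ 0 then Point.vertex (Γ.src e)
  else Point.vertex (Γ.tgt e)

/-- The topology of the space obtained by gluing the edges at the vertices: a set is open if and
only if its preimage under the parametrization of each edge is open. -/
noncomputable instance : TopologicalSpace Γ.Point :=
  ⨆ e, TopologicalSpace.coinduced (Γ.point e) inferInstance

noncomputable instance : MeasurableSpace Γ.Point := borel _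

instance : BorelSpace Γ.Point := ⟨rfl⟩

/-- A function on the graph, read on the edge `e` in the distinguished coordinate. -/
noncomputable def onEdge (f : Γ.Point → ℝ) (e : E) : ℝ → ℝ := fun t => f (Γ.point e t)

open Classical in
/-- The sum of the derivatives of `f` at the point `p` over all directions emanating from `p`.
There are two directions at an interior point of an edge; at a vertex there is one for each edge
end at that vertex, so that a self-loop contributes two. -/
noncomputable def slopeSum [Fintype E] (f : Γ.Point → ℝ) : Γ.Point → ℝ
  | .vertex v =>
      ∑ e, ((if Γ.src e = v then derivWithin (Γ.onEdge f e) (Ici 0) 0 else 0)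
        + (if Γ.tgt e = v then -derivWithin (Γ.onEdge f e) (Iic (Γ.len e)) (Γ.len e) else 0))
  | .interior e t _ =>
      derivWithin (Γ.onEdge f e) (Ici t) t - derivWithin (Γ.onEdge f e) (Iic t) t

open Classical in
/-- `f` is the voltage function `x ↦ j_z(x, y)`: a continuous function with `f z = 0` and
`Δ f = δ_y - δ_z`, where `Δ f = -f'' dx - ∑ p, (sum of the outgoing slopes of f at p) δ_p`.
So `f'' = 0` outside a finite set of points, and the atoms at all points are prescribed. -/
structure IsVoltage [Fintype E] (z y : Γ.Point) (f : Γ.Point → ℝ) : Prop where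
  continuous : Continuous f
  reference : f z = 0
  second_deriv : ∃ S : Set Γ.Point, S.Finite ∧ ∀ e, ∀ t ∈ Ioo 0 (Γ.len e), Γ.point e t ∉ S →
    ContDiffAt ℝ 2 (Γ.onEdge f e) t ∧ deriv (deriv (Γ.onEdge f e)) t = 0
  slopes : ∀ p, -Γ.slopeSum f p = (if p = y then 1 else 0) - (if p = z then 1 else 0)

/-- The voltage function `j_z(x, y)`: the voltage difference between `x` and `z` when unit
current enters at `y` and exits at `z`. -/
noncomputable def voltage [Fintype E] (z x y : Γ.Point) : ℝ :=
  Classical.epsilon (Γ.IsVoltage z y) x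

/-- The effective resistance `r(x, y) = j_x(y, y)`. -/
noncomputable def resistance [Fintype E] (x y : Γ.Point) : ℝ := Γ.voltage x y y

open Classical in
/-- `R_e`: the effective resistance between the end points of the edge `e` in the graph `Γ - e`,
equal to `∞` if `Γ - e` is not connected. -/
noncomputable def deletedResistance [Fintype E] (e : E) : ℝ≥0∞ :=
  if (Γ.deleteEdge e).Connected then
    ENNReal.ofReal
      ((Γ.deleteEdge e).resistance (Point.vertex (Γ.src e)) (Point.vertex (Γ.tgt e)))
  else ⊤

/-- The function `j_μ(x, y) = ∫ j_ζ(x, y) dμ(ζ)` of a real-valued signed Borel measure `μ`. -/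
noncomputable def voltageMeasure [Fintype E] (μ : SignedMeasure Γ.Point) (x y : Γ.Point) : ℝ :=
  ∫ᵛ ζ, Γ.voltage ζ x y ∂•μ

/-- `t` is the tau constant: there is a canonical measure, that is, a real-valued signed Borel
measure `μ` of total mass `1` for which `j_μ(x, x)` is constant, and `t` is one half of that
constant. -/
def IsTauConstant [Fintype E] (t : ℝ) : Prop :=
  ∃ μ : SignedMeasure Γ.Point, μ univ = 1 ∧ ∀ x, (1 / 2 : ℝ) * Γ.voltageMeasure μ x x = t

/-- The tau constant `τ(Γ)`. -/
noncomputable def tau [Fintype E] : ℝ := Classical.epsilon Γ.IsTauConstant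

end MetrizedGraph

/-! Everything is expressed through a Green function `G` of the discrete Laplacian on the vertices,
grounded at a vertex `o`. Interpolating `G` bilinearly along the edges and adding the Dirichlet
Green function `tent` of each edge gives the Green function g = `green G` of the metrized graph, and
j_z(x,y) = g(x,y) - g(x,z) - g(z,y) + g(z,z) (`IsGreen.voltage_eq`).

Let r_e be the resistance in Γ between the ends of e. The canonical measure μ has constant density
d_e = (1 - r_e/L_e)/L_e along e and suitable point masses at the vertices, chosen so that ∫ g(y,x)
dμ(y) = g(x,x)/2 (`IsGreen.canonicalIntegral_green`). The terms in x then cancel from ∫ j_z(x,x)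
dμ(z), leaving the constant ∫ g(z,z) dμ(z). Since j_z(x,x) is symmetric in x and z, integrating it
against μ and any other admissible measure in both orders shows that the constant is the same
(`IsGreen.isTauConstant_iff`).

Evaluating the constant gives τ = (1/4) ∑ (G(p,p) - G(q,q))²/L_e + (1/12) ∑ d_e² L_e³, with p, q the
ends of e (`IsGreen.tau_eq`). The first sum is nonnegative and is dropped. The parallel law gives
d_e = 1/(L_e + R_e) (`IsGreen.edgeDensity_eq_inv`), and Hölder's inequality
(`sum_pow_three_div_sq_le`) bounds ∑ L_e³/(L_e + R_e)² below by ℓ³/(ℓ + ∑ R_e)².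

When adjacent vertices are multiply joined, R_e may be replaced by the mean length ρ_e of the other
edges parallel to e, because some such edge is no longer than the mean
(`IsGreen.le_edgeDensity_of_parallel`). Double counting gives ∑ ρ_e ≤ ℓ, so the bound becomes (1/12)
ℓ³/(2ℓ)² = ℓ/48. -/

namespace MetrizedGraph

variable {V E : Type*} (Γ : MetrizedGraph V E)

/-! ### The discrete Laplacian and its grounded Green function. -/

lemma Connected.eq_of_forall_edge {Γ : MetrizedGraph V E} (hΓ : Γ.Connected) {α : Type*} {f : V → α}
    (h : ∀ e, f (Γ.src e) = f (Γ.tgt e)) (v w : V) : f v = f w := by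
  obtain ⟨p⟩ := hΓ.preconnected v w
  induction p with
  | nil => rfl
  | cons hadj _ ih =>
    rw [← ih]
    rw [SimpleGraph.fromRel_adj] at hadj
    obtain ⟨-, ⟨e, rfl, rfl⟩ | ⟨e, rfl, rfl⟩⟩ := hadj
    · exact h e
    · exact (h e).symm

section Laplacian

variable [Fintype E]

open Classical in
/-- The discrete Laplacian of the weighted graph in which the edge `e` has conductance
`(len e)⁻¹`. -/
noncomputable def laplacian (f : V → ℝ) (v : V) : ℝ :=
  ∑ e, ((if Γ.src e = v then (f (Γ.src e) - f (Γ.tgt e)) / Γ.len e else 0)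
    + (if Γ.tgt e = v then (f (Γ.tgt e) - f (Γ.src e)) / Γ.len e else 0))

lemma laplacian_add (f g : V → ℝ) (v : V) :
    Γ.laplacian (fun v => f v + g v) v = Γ.laplacian f v + Γ.laplacian g v := by
  simp only [laplacian, ← Finset.sum_add_distrib]
  refine Finset.sum_congr rfl fun e _ => ?_
  split_ifs <;> ring

lemma laplacian_const_mul (c : ℝ) (f : V → ℝ) (v : V) :
    Γ.laplacian (fun v => c * f v) v = c * Γ.laplacian f v := by
  simp only [laplacian, Finset.mul_sum]
  refine Finset.sum_congr rfl fun e _ => ?_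
  split_ifs <;> ring

variable [Fintype V]

/-- Summation by parts: each edge is collected from its two ends, which yields the Dirichlet form.
Self-adjointness, total mass zero and the maximum principle substitute below all come from it. -/
lemma sum_mul_laplacian (g f : V → ℝ) :
    ∑ v, g v * Γ.laplacian f v
      = ∑ e, (g (Γ.src e) - g (Γ.tgt e)) * (f (Γ.src e) - f (Γ.tgt e)) / Γ.len e := by
  classical
  simp only [laplacian, Finset.mul_sum]
  rw [Finset.sum_comm]
  refine Finset.sum_congr rfl fun e _ => ?_
  simp only [mul_add, mul_ite, mul_zero, Finset.sum_add_distrib, Finset.sum_ite_eq,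
    Finset.mem_univ, if_true]
  ring

lemma sum_mul_laplacian_comm (g f : V → ℝ) :
    ∑ v, g v * Γ.laplacian f v = ∑ v, f v * Γ.laplacian g v := by
  simp only [sum_mul_laplacian]
  exact Finset.sum_congr rfl fun e _ => by ring

lemma sum_laplacian (f : V → ℝ) : ∑ v, Γ.laplacian f v = 0 := by
  simpa using Γ.sum_mul_laplacian (fun _ => 1) f

variable {Γ}

lemma Connected.eq_of_laplacian_eq_zero (hΓ : Γ.Connected) {f : V → ℝ}
    (h : ∀ v, Γ.laplacian f v = 0) (v w : V) : f v = f w := by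
  refine hΓ.eq_of_forall_edge (fun e => ?_) v w
  have hsum := Γ.sum_mul_laplacian f f
  simp only [h, mul_zero, Finset.sum_const_zero] at hsum
  have hnn : ∀ e ∈ (Finset.univ : Finset E),
      0 ≤ (f (Γ.src e) - f (Γ.tgt e)) * (f (Γ.src e) - f (Γ.tgt e)) / Γ.len e :=
    fun e _ => div_nonneg (mul_self_nonneg _) (Γ.len_pos e).le
  have h0 := (Finset.sum_eq_zero_iff_of_nonneg hnn).1 hsum.symm e (Finset.mem_univ e)
  rw [div_eq_zero_iff, or_iff_left (Γ.len_pos e).ne', mul_self_eq_zero] at h0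
  exact sub_eq_zero.1 h0

open Classical in
/-- `G w` is the potential on the vertices that is `0` at `o` when unit current enters at `w` and
exits at `o`. -/
structure IsGreen (Γ : MetrizedGraph V E) (o : V) (G : V → V → ℝ) : Prop where
  ground : ∀ w, G w o = 0
  laplacian : ∀ w v, Γ.laplacian (G w) v = (if v = w then 1 else 0) - (if v = o then 1 else 0)

theorem Connected.exists_isGreen (hΓ : Γ.Connected) (o : V) : ∃ G, Γ.IsGreen o G := by
  classical
  -- The Laplacian is singular, so the rank-one term f(o)δ_o is added. As Laplacians have total mass
  -- zero, the total mass of `T f` is f(o); this gives injectivity, and it also forces the solution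
  -- for δ_w - δ_o, of mass zero, to vanish at `o`.
  let T : (V → ℝ) →ₗ[ℝ] (V → ℝ) :=
    { toFun := fun f v => Γ.laplacian f v + if v = o then f o else 0
      map_add' := fun f g => by
        ext v
        have := Γ.laplacian_add f g v
        simp only [Pi.add_apply] at this ⊢
        change Γ.laplacian (fun v => f v + g v) v + _ = _
        rw [this]
        split_ifs <;> ring
      map_smul' := fun c f => by
        ext v
        change Γ.laplacian (fun v => c * f v) v + _ = c * (_ + _)
        rw [laplacian_const_mul, mul_add]
        simp }
  have hT : ∀ f v, T f v = Γ.laplacian f v + if v = o then f o else 0 := fun _ _ => rfl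
  have hsum : ∀ f, ∑ v, T f v = f o := fun f => by
    simp [hT, Finset.sum_add_distrib, sum_laplacian]
  have hinj : Function.Injective T := by
    rw [← LinearMap.ker_eq_bot, LinearMap.ker_eq_bot']
    intro f hf
    have ho : f o = 0 := by rw [← hsum f, hf]; simp
    have hlap : ∀ v, Γ.laplacian f v = 0 := fun v => by
      have := congrFun hf v
      simpa [hT, ho] using this
    ext v
    rw [hΓ.eq_of_laplacian_eq_zero hlap v o, ho, Pi.zero_apply]
  have hsurj := LinearMap.injective_iff_surjective.1 hinj
  choose G hG using fun w : V =>
    hsurj fun v => (if v = w then 1 else 0) - (if v = o then 1 else 0)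
  have ho : ∀ w, G w o = 0 := fun w => by rw [← hsum (G w), hG]; simp
  refine ⟨G, ho, fun w v => ?_⟩
  have := congrFun (hG w) v
  simpa [hT, ho] using this

namespace IsGreen

variable {o : V} {G : V → V → ℝ} (hG : Γ.IsGreen o G)
include hG

lemma sum_mul_laplacian (f : V → ℝ) (w : V) : ∑ v, G w v * Γ.laplacian f v = f w - f o := by
  classical
  rw [sum_mul_laplacian_comm]
  simp [hG.laplacian, mul_sub, Finset.sum_sub_distrib]

lemma symm (v w : V) : G v w = G w v := by
  classical
  have h := hG.sum_mul_laplacian (G w) v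
  have h' := hG.sum_mul_laplacian (G v) w
  rw [sum_mul_laplacian_comm] at h'
  rw [hG.ground, sub_zero] at h h'
  rw [← h', h]

end IsGreen

end Laplacian

end MetrizedGraph

/-! ### Affine functions of one real variable. -/

lemma exists_slope_of_deriv_deriv_eq_zero {F : ℝ → ℝ} {a b : ℝ} (hF : Continuous F)
    (h : ∀ t ∈ Ioo a b, ContDiffAt ℝ 2 F t ∧ deriv (deriv F) t = 0) :
    ∃ m, ∀ s ∈ Icc a b, ∀ t ∈ Icc a b, F s - F t = m * (s - t) := by
  rcases lt_or_ge a b with hab | hab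
  swap
  · refine ⟨0, fun s hs t ht => ?_⟩
    rw [le_antisymm (hs.2.trans hab) hs.1, le_antisymm (ht.2.trans hab) ht.1]
    simp
  have hd1 : ∀ t ∈ Ioo a b, DifferentiableAt ℝ F t :=
    fun t ht => (h t ht).1.differentiableAt (by norm_num)
  have hd2 : DifferentiableOn ℝ (deriv F) (Ioo a b) := fun t ht =>
    (((h t ht).1.derivWithin (m := 1) (by norm_num)).differentiableAt
      (by norm_num)).differentiableWithinAt
  obtain ⟨m, hm⟩ := isOpen_Ioo.exists_is_const_of_deriv_eq_zero isPreconnected_Ioo hd2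
    fun t ht => (h t ht).2
  have hlin : ∀ t, HasDerivAt (fun s => m * s) m t := fun t => by
    simpa using (hasDerivAt_id t).const_mul m
  obtain ⟨c, hc⟩ := isOpen_Ioo.exists_is_const_of_deriv_eq_zero isPreconnected_Ioo
    (f := fun s => F s - m * s)
    (fun t ht => ((hd1 t ht).sub (hlin t).differentiableAt).differentiableWithinAt)
    (fun t ht => by
      have := ((hd1 t ht).hasDerivAt.sub (hlin t)).deriv
      rw [hm t ht, sub_self] at this
      exact this)
  have hcl : EqOn F (fun s => c + m * s) (closure (Ioo a b)) :=
    EqOn.closure (fun t ht => by have := hc t ht; linarith) hF (by fun_prop)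
  rw [closure_Ioo hab.ne] at hcl
  refine ⟨m, fun s hs t ht => ?_⟩
  rw [hcl hs, hcl ht]
  ring

lemma deriv_deriv_sub_eq_zero {F G : ℝ → ℝ} {t : ℝ}
    (hF : ContDiffAt ℝ 2 F t ∧ deriv (deriv F) t = 0)
    (hG : ContDiffAt ℝ 2 G t ∧ deriv (deriv G) t = 0) :
    ContDiffAt ℝ 2 (F - G) t ∧ deriv (deriv (F - G)) t = 0 := by
  refine ⟨hF.1.sub hG.1, ?_⟩
  have h := iteratedDeriv_sub (n := 2) hF.1 hG.1
  simp only [iteratedDeriv_succ, iteratedDeriv_zero] at h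
  rw [h, hF.2, hG.2, sub_zero]

lemma deriv_deriv_eq_zero_of_eventuallyEq {F : ℝ → ℝ} {t a b : ℝ}
    (h : F =ᶠ[𝓝 t] fun s => a + b * s) : ContDiffAt ℝ 2 F t ∧ deriv (deriv F) t = 0 := by
  refine ⟨ContDiffAt.congr_of_eventuallyEq (by fun_prop) h, ?_⟩
  have hd : deriv (fun s : ℝ => a + b * s) = fun _ => b := by
    ext s
    simp
  rw [h.deriv.deriv_eq, hd, deriv_const]

lemma hasDerivWithinAt_Ici_of_slope {F : ℝ → ℝ} {a b m : ℝ} (hab : a < b)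
    (h : ∀ s ∈ Icc a b, F s - F a = m * (s - a)) : HasDerivWithinAt F m (Ici a) a := by
  have h1 : HasDerivWithinAt (fun s => F a + m * (s - a)) m (Ici a) a := by
    simpa using ((((hasDerivAt_id a).sub_const a).const_mul m).const_add (F a)).hasDerivWithinAt
  refine h1.congr_of_eventuallyEq ?_ (by simp)
  filter_upwards [Icc_mem_nhdsGE hab] with s hs
  linarith [h s hs]

lemma hasDerivWithinAt_Iic_of_slope {F : ℝ → ℝ} {a b m : ℝ} (hab : a < b)
    (h : ∀ s ∈ Icc a b, F s - F b = m * (s - b)) : HasDerivWithinAt F m (Iic b) b := by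
  have h1 : HasDerivWithinAt (fun s => F b + m * (s - b)) m (Iic b) b := by
    simpa using ((((hasDerivAt_id b).sub_const b).const_mul m).const_add (F b)).hasDerivWithinAt
  refine h1.congr_of_eventuallyEq ?_ (by simp)
  filter_upwards [Icc_mem_nhdsLE hab] with s hs
  linarith [h s hs]

/-! ### Piecewise affine functions on the metrized graph and uniqueness of voltages. -/

namespace MetrizedGraph

variable {V E : Type*} (Γ : MetrizedGraph V E)

section Points

lemma point_zero (e : E) : Γ.point e 0 = .vertex (Γ.src e) := by
  simp [point]

lemma point_len (e : E) : Γ.point e (Γ.len e) = .vertex (Γ.tgt e) := by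
  simp [point, Γ.len_pos e]

lemma point_of_mem_Ioo {e : E} {t : ℝ} (ht : t ∈ Ioo 0 (Γ.len e)) :
    Γ.point e t = .interior e t ht := by
  rw [point, dif_pos ht]

lemma point_clamp (e : E) (t : ℝ) : Γ.point e (max 0 (min t (Γ.len e))) = Γ.point e t := by
  have hL := Γ.len_pos e
  by_cases ht : t ∈ Ioo 0 (Γ.len e)
  · rw [min_eq_left ht.2.le, max_eq_right ht.1.le]
  · rw [mem_Ioo, not_and_or, not_lt, not_lt] at ht
    rcases ht with ht | ht
    · rw [min_eq_left (ht.trans hL.le), max_eq_left ht, point_zero, point,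
        dif_neg (fun h => ht.not_gt h.1), if_pos ht]
    · rw [min_eq_right ht, max_eq_right hL.le, point_len, point,
        dif_neg (fun h => ht.not_gt h.2), if_neg (hL.trans_le ht).not_ge]

lemma continuous_point (e : E) : Continuous (Γ.point e) :=
  continuous_iff_coinduced_le.2 (le_iSup (fun e => TopologicalSpace.coinduced (Γ.point e) _) e)

variable {Γ}

lemma continuous_iff_onEdge {f : Γ.Point → ℝ} : Continuous f ↔ ∀ e, Continuous (Γ.onEdge f e) :=
  ⟨fun h e => h.comp (Γ.continuous_point e),
    fun h => continuous_iSup_dom.2 fun e => continuous_coinduced_dom.2 (h e)⟩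

/-- By `point_clamp` the extended parametrization factors through the clamping map onto `[0, len
e]`, so a formula valid on that segment suffices. -/
lemma continuous_of_eqOn_edge {f : Γ.Point → ℝ}
    (h : ∀ e, ∃ F : ℝ → ℝ, Continuous F ∧ ∀ t ∈ Icc 0 (Γ.len e), f (Γ.point e t) = F t) :
    Continuous f := by
  rw [continuous_iff_onEdge]
  intro e
  obtain ⟨F, hF, hfF⟩ := h e
  have : Γ.onEdge f e = fun t => F (max 0 (min t (Γ.len e))) := by
    ext t
    rw [onEdge, ← point_clamp, hfF]
    exact ⟨le_max_left _ _, max_le (Γ.len_pos e).le (min_le_right _ _)⟩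
  rw [this]
  fun_prop

lemma exists_abs_le_of_continuous [Finite V] [Finite E] {f : Γ.Point → ℝ} (hf : Continuous f) :
    ∃ C, ∀ x, |f x| ≤ C := by
  have hb := fun e => (isCompact_Icc (a := (0 : ℝ)) (b := Γ.len e)).exists_bound_of_continuousOn
    (continuous_iff_onEdge.1 hf e).continuousOn
  choose C hC using hb
  obtain ⟨A, hA⟩ := (finite_range fun v => |f (.vertex v)|).bddAbove
  obtain ⟨B, hB⟩ := (finite_range C).bddAbove
  refine ⟨max A B, fun x => ?_⟩
  cases x with
  | vertex v => exact le_max_of_le_left (hA ⟨v, rfl⟩)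
  | interior e t ht =>
    have := hC e t ⟨ht.1.le, ht.2.le⟩
    rw [onEdge, Γ.point_of_mem_Ioo ht] at this
    exact le_max_of_le_right (this.trans (hB ⟨e, rfl⟩))

end Points

/-- `f` is continuous, and off a finite set of points its second derivative vanishes. -/
structure PiecewiseAffine (f : Γ.Point → ℝ) : Prop where
  continuous : Continuous f
  second_deriv : ∃ S : Set Γ.Point, S.Finite ∧ ∀ e, ∀ t ∈ Ioo 0 (Γ.len e), Γ.point e t ∉ S →
    ContDiffAt ℝ 2 (Γ.onEdge f e) t ∧ deriv (deriv (Γ.onEdge f e)) t = 0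

variable {Γ}

namespace PiecewiseAffine

variable {f g : Γ.Point → ℝ}

lemma sub (hf : Γ.PiecewiseAffine f) (hg : Γ.PiecewiseAffine g) :
    Γ.PiecewiseAffine fun x => f x - g x := by
  obtain ⟨S, hS, h⟩ := hf.second_deriv
  obtain ⟨T, hT, h'⟩ := hg.second_deriv
  refine ⟨hf.continuous.sub hg.continuous, S ∪ T, hS.union hT, fun e t ht hST => ?_⟩
  rw [mem_union, not_or] at hST
  exact deriv_deriv_sub_eq_zero (h e t ht hST.1) (h' e t ht hST.2)

lemma const (c : ℝ) : Γ.PiecewiseAffine fun _ => c :=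
  ⟨continuous_const, ∅, finite_empty, fun _ _ _ _ =>
    deriv_deriv_eq_zero_of_eventuallyEq (a := c) (b := 0) (.of_forall fun s => by simp [onEdge])⟩

/-- The parametrization is injective on the open edge, so a finite exceptional set of points pulls
back to a finite set of parameters. -/
lemma exists_finite_edge (hf : Γ.PiecewiseAffine f) (e : E) :
    ∃ A : Set ℝ, A.Finite ∧ ∀ t ∈ Ioo 0 (Γ.len e), t ∉ A →
      ContDiffAt ℝ 2 (Γ.onEdge f e) t ∧ deriv (deriv (Γ.onEdge f e)) t = 0 := by
  obtain ⟨S, hS, h⟩ := hf.second_deriv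
  refine ⟨Ioo 0 (Γ.len e) ∩ Γ.point e ⁻¹' S, ?_, fun t ht hA => h e t ht fun hs => hA ⟨ht, hs⟩⟩
  refine (hS.preimage (f := fun t : Ioo 0 (Γ.len e) => Γ.point e t) ?_).image Subtype.val |>.subset ?_
  · rintro ⟨s, hs⟩ - ⟨t, ht⟩ - hst
    simp only [Γ.point_of_mem_Ioo hs, Γ.point_of_mem_Ioo ht] at hst
    simpa using hst
  · rintro t ⟨ht, hS⟩
    exact ⟨⟨t, ht⟩, hS, rfl⟩

lemma exists_slope_right (hf : Γ.PiecewiseAffine f) (e : E) {t : ℝ} (ht : t ∈ Ico 0 (Γ.len e)) :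
    ∃ b > t, ∃ m, ∀ s ∈ Icc t b, Γ.onEdge f e s - Γ.onEdge f e t = m * (s - t) := by
  obtain ⟨A, hA, h⟩ := hf.exists_finite_edge e
  -- The point `t` may itself be a kink; only exceptional parameters other than `t` have to be
  -- avoided.
  have h1 : ∀ᶠ s in 𝓝[>] t, s ∉ A \ {t} :=
    nhdsWithin_le_nhds ((hA.subset sdiff_subset).isClosed.isOpen_compl.mem_nhds (by simp))
  have h2 : ∀ᶠ s in 𝓝[>] t, s ∈ Ioo t (Γ.len e) := Ioo_mem_nhdsGT ht.2
  obtain ⟨b, hb, hsub⟩ := (mem_nhdsGT_iff_exists_Ioo_subset).1 (h1.and h2)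
  obtain ⟨m, hm⟩ := exists_slope_of_deriv_deriv_eq_zero (a := t) (b := b)
    (continuous_iff_onEdge.1 hf.continuous e) fun s hs =>
      h s ⟨ht.1.trans_lt hs.1, (hsub hs).2.2⟩ fun hsA => (hsub hs).1 ⟨hsA, hs.1.ne'⟩
  exact ⟨b, hb, m, fun s hs => hm s hs t ⟨le_rfl, hb.le⟩⟩

lemma exists_slope_left (hf : Γ.PiecewiseAffine f) (e : E) {t : ℝ} (ht : t ∈ Ioc 0 (Γ.len e)) :
    ∃ b < t, ∃ m, ∀ s ∈ Icc b t, Γ.onEdge f e s - Γ.onEdge f e t = m * (s - t) := by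
  obtain ⟨A, hA, h⟩ := hf.exists_finite_edge e
  have h1 : ∀ᶠ s in 𝓝[<] t, s ∉ A \ {t} :=
    nhdsWithin_le_nhds ((hA.subset sdiff_subset).isClosed.isOpen_compl.mem_nhds (by simp))
  have h2 : ∀ᶠ s in 𝓝[<] t, s ∈ Ioo 0 t := Ioo_mem_nhdsLT ht.1
  obtain ⟨b, hb, hsub⟩ := (mem_nhdsLT_iff_exists_Ioo_subset).1 (h1.and h2)
  obtain ⟨m, hm⟩ := exists_slope_of_deriv_deriv_eq_zero (a := b) (b := t)
    (continuous_iff_onEdge.1 hf.continuous e) fun s hs =>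
      h s ⟨(hsub hs).2.1, hs.2.trans_le ht.2⟩ fun hsA => (hsub hs).1 ⟨hsA, hs.2.ne⟩
  exact ⟨b, hb, m, fun s hs => hm s hs t ⟨hb.le, le_rfl⟩⟩

lemma differentiableWithinAt_Ici (hf : Γ.PiecewiseAffine f) (e : E) {t : ℝ}
    (ht : t ∈ Ico 0 (Γ.len e)) : DifferentiableWithinAt ℝ (Γ.onEdge f e) (Ici t) t := by
  obtain ⟨b, hb, m, hm⟩ := hf.exists_slope_right e ht
  exact (hasDerivWithinAt_Ici_of_slope hb hm).differentiableWithinAt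

lemma differentiableWithinAt_Iic (hf : Γ.PiecewiseAffine f) (e : E) {t : ℝ}
    (ht : t ∈ Ioc 0 (Γ.len e)) : DifferentiableWithinAt ℝ (Γ.onEdge f e) (Iic t) t := by
  obtain ⟨b, hb, m, hm⟩ := hf.exists_slope_left e ht
  exact (hasDerivWithinAt_Iic_of_slope hb hm).differentiableWithinAt

lemma slopeSum_sub [Fintype E] (hf : Γ.PiecewiseAffine f) (hg : Γ.PiecewiseAffine g)
    (p : Γ.Point) : Γ.slopeSum (fun x => f x - g x) p = Γ.slopeSum f p - Γ.slopeSum g p := by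
  have hR : ∀ e, ∀ t ∈ Ico 0 (Γ.len e), derivWithin (Γ.onEdge (fun x => f x - g x) e) (Ici t) t
      = derivWithin (Γ.onEdge f e) (Ici t) t - derivWithin (Γ.onEdge g e) (Ici t) t :=
    fun e t ht => derivWithin_sub (hf.differentiableWithinAt_Ici e ht)
      (hg.differentiableWithinAt_Ici e ht)
  have hL : ∀ e, ∀ t ∈ Ioc 0 (Γ.len e), derivWithin (Γ.onEdge (fun x => f x - g x) e) (Iic t) t
      = derivWithin (Γ.onEdge f e) (Iic t) t - derivWithin (Γ.onEdge g e) (Iic t) t :=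
    fun e t ht => derivWithin_sub (hf.differentiableWithinAt_Iic e ht)
      (hg.differentiableWithinAt_Iic e ht)
  cases p with
  | vertex v =>
    simp only [slopeSum, ← Finset.sum_sub_distrib]
    refine Finset.sum_congr rfl fun e _ => ?_
    rw [hR e 0 ⟨le_rfl, Γ.len_pos e⟩, hL e _ ⟨Γ.len_pos e, le_rfl⟩]
    split_ifs <;> ring
  | interior e t ht =>
    simp only [slopeSum]
    rw [hR e t ⟨ht.1.le, ht.2⟩, hL e t ⟨ht.1, ht.2.le⟩]
    ring

lemma slopeSum_const [Fintype E] (c : ℝ) (p : Γ.Point) : Γ.slopeSum (fun _ => c) p = 0 := by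
  have h : ∀ e, Γ.onEdge (fun _ => c) e = fun _ => c := fun _ => rfl
  cases p <;> simp [slopeSum, h]

end PiecewiseAffine

/-- On an edge along which `f` is affine, the one-sided derivatives at the two ends are the
difference quotient. -/
lemma slopeSum_vertex_of_affine [Fintype E] {f : Γ.Point → ℝ} (F : V → ℝ)
    (h : ∀ e, ∀ t ∈ Icc 0 (Γ.len e),
      f (Γ.point e t) = F (Γ.src e) + (F (Γ.tgt e) - F (Γ.src e)) / Γ.len e * t) (v : V) :
    -Γ.slopeSum f (.vertex v) = Γ.laplacian F v := by
  simp only [slopeSum, laplacian, ← Finset.sum_neg_distrib]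
  refine Finset.sum_congr rfl fun e _ => ?_
  have hL := Γ.len_pos e
  rw [(hasDerivWithinAt_Ici_of_slope (F := Γ.onEdge f e)
      (m := (F (Γ.tgt e) - F (Γ.src e)) / Γ.len e) hL fun s hs => ?_).derivWithin
      (uniqueDiffWithinAt_Ici _),
    (hasDerivWithinAt_Iic_of_slope (F := Γ.onEdge f e)
      (m := (F (Γ.tgt e) - F (Γ.src e)) / Γ.len e) hL fun s hs => ?_).derivWithin
      (uniqueDiffWithinAt_Iic _)]
  · split_ifs <;> ring
  · simp only [onEdge]
    rw [h e s hs, h e _ ⟨hL.le, le_rfl⟩]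
    ring
  · simp only [onEdge]
    rw [h e s hs, h e _ ⟨le_rfl, hL.le⟩]
    ring

/-- Vanishing slope sums at interior points rule out kinks, so `f` is affine along whole edges. The
vertex conditions then say that its restriction to the vertices is harmonic, hence constant by
connectedness. -/
lemma PiecewiseAffine.eq_of_slopeSum_eq_zero [Fintype E] [Fintype V] (hΓ : Γ.Connected)
    {f : Γ.Point → ℝ} (hf : Γ.PiecewiseAffine f) (h0 : ∀ p, Γ.slopeSum f p = 0) (x y : Γ.Point) :
    f x = f y := by
  have hedge : ∀ e, ∃ m, ∀ s ∈ Icc 0 (Γ.len e), ∀ t ∈ Icc 0 (Γ.len e),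
      Γ.onEdge f e s - Γ.onEdge f e t = m * (s - t) := by
    intro e
    refine exists_slope_of_deriv_deriv_eq_zero (continuous_iff_onEdge.1 hf.continuous e)
      fun t ht => ?_
    obtain ⟨b, hb, m, hm⟩ := hf.exists_slope_right e ⟨ht.1.le, ht.2⟩
    obtain ⟨a, ha, n, hn⟩ := hf.exists_slope_left e ⟨ht.1, ht.2.le⟩
    -- The left and right slopes agree, so no interior point is exceptional any more.
    have hmn : m = n := by
      have := h0 (.interior e t ht)
      simp only [slopeSum] at this
      rw [(hasDerivWithinAt_Ici_of_slope hb hm).derivWithin (uniqueDiffWithinAt_Ici _),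
        (hasDerivWithinAt_Iic_of_slope ha hn).derivWithin (uniqueDiffWithinAt_Iic _)] at this
      linarith
    subst hmn
    refine deriv_deriv_eq_zero_of_eventuallyEq (a := Γ.onEdge f e t - m * t) (b := m) ?_
    filter_upwards [Icc_mem_nhds ha hb] with s hs
    rcases le_total s t with hst | hst
    · linarith [hn s ⟨hs.1, hst⟩]
    · linarith [hm s ⟨hst, hs.2⟩]
  have haff : ∀ e, ∀ t ∈ Icc 0 (Γ.len e), f (Γ.point e t) = f (.vertex (Γ.src e)) +
      (f (.vertex (Γ.tgt e)) - f (.vertex (Γ.src e))) / Γ.len e * t := by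
    intro e t ht
    obtain ⟨m, hm⟩ := hedge e
    have hL := Γ.len_pos e
    have h1 := hm t ht 0 ⟨le_rfl, hL.le⟩
    have h2 := hm _ ⟨hL.le, le_rfl⟩ 0 ⟨le_rfl, hL.le⟩
    simp only [onEdge, point_zero, point_len, sub_zero] at h1 h2
    rw [h2, mul_div_cancel_right₀ _ hL.ne', ← h1]
    ring
  have hconst := hΓ.eq_of_laplacian_eq_zero fun v => by
    rw [← slopeSum_vertex_of_affine (f := f) (fun v => f (.vertex v)) haff v, h0, neg_zero]
  have hx : ∀ x, ∃ v, f x = f (.vertex v) := by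
    rintro (v | ⟨e, t, ht⟩)
    · exact ⟨v, rfl⟩
    · refine ⟨Γ.src e, ?_⟩
      rw [← Γ.point_of_mem_Ioo ht, haff e t ⟨ht.1.le, ht.2.le⟩, hconst (Γ.tgt e) (Γ.src e)]
      simp
  obtain ⟨v, hv⟩ := hx x
  obtain ⟨w, hw⟩ := hx y
  rw [hv, hw, hconst v w]

namespace IsVoltage

variable [Fintype E] {z y : Γ.Point} {f g : Γ.Point → ℝ}

lemma piecewiseAffine (hf : Γ.IsVoltage z y f) : Γ.PiecewiseAffine f :=
  ⟨hf.continuous, hf.second_deriv⟩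

lemma unique [Fintype V] (hΓ : Γ.Connected) (hf : Γ.IsVoltage z y f) (hg : Γ.IsVoltage z y g) :
    f = g := by
  have h := (hf.piecewiseAffine.sub hg.piecewiseAffine).eq_of_slopeSum_eq_zero hΓ fun p => by
    rw [hf.piecewiseAffine.slopeSum_sub hg.piecewiseAffine]
    linarith [hf.slopes p, hg.slopes p]
  ext x
  have := h x z
  rw [hf.reference, hg.reference] at this
  linarith

lemma voltage_eq [Fintype V] (hΓ : Γ.Connected) (hf : Γ.IsVoltage z y f) (x : Γ.Point) :
    Γ.voltage z x y = f x := by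
  have h : Γ.IsVoltage z y (Classical.epsilon (Γ.IsVoltage z y)) := Classical.epsilon_spec ⟨f, hf⟩
  rw [voltage, h.unique hΓ hf]

end IsVoltage

end MetrizedGraph

/-! ### The Green function of the metrized graph. -/

namespace MetrizedGraph

variable {V E : Type*} {Γ : MetrizedGraph V E}

/-- The extension of a function on the vertices that is affine along each edge. -/
noncomputable def interp (F : V → ℝ) : Γ.Point → ℝ
  | .vertex v => F v
  | .interior e t _ => F (Γ.src e) + (F (Γ.tgt e) - F (Γ.src e)) / Γ.len e * t

section interp

variable (F F' : V → ℝ)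

@[simp] lemma interp_vertex (v : V) : interp (Γ := Γ) F (.vertex v) = F v := rfl

lemma interp_point (e : E) {t : ℝ} (ht : t ∈ Icc 0 (Γ.len e)) :
    interp F (Γ.point e t) = F (Γ.src e) + (F (Γ.tgt e) - F (Γ.src e)) / Γ.len e * t := by
  rcases eq_or_lt_of_le ht.1 with rfl | h0
  · simp [point_zero]
  rcases eq_or_lt_of_le ht.2 with rfl | h1
  · rw [point_len, interp_vertex, div_mul_cancel₀ _ (Γ.len_pos e).ne']
    ring
  · rw [Γ.point_of_mem_Ioo ⟨h0, h1⟩]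
    rfl

lemma interp_sub (x : Γ.Point) : interp (fun v => F v - F' v) x = interp F x - interp F' x := by
  cases x <;> simp only [interp]
  ring

lemma interp_const (c : ℝ) (x : Γ.Point) : interp (fun _ => c) x = c := by
  cases x <;> simp [interp]

lemma interp_interp_comm (G : V → V → ℝ) (x y : Γ.Point) :
    interp (fun v => interp (G v) y) x = interp (fun w => interp (fun v => G v w) x) y := by
  cases x <;> cases y <;> simp only [interp]
  ring

lemma laplacian_interp [Fintype E] (G : V → V → ℝ) (y : Γ.Point) (v : V) :
    Γ.laplacian (fun u => interp (G u) y) v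
      = interp (fun w => Γ.laplacian (fun u => G u w) v) y := by
  cases y with
  | vertex w => rfl
  | interior e t ht =>
    simp only [interp]
    have h : ∀ u, G u (Γ.src e) + (G u (Γ.tgt e) - G u (Γ.src e)) / Γ.len e * t
        = (1 - t / Γ.len e) * G u (Γ.src e) + t / Γ.len e * G u (Γ.tgt e) := fun u => by ring
    simp only [h, laplacian_add, laplacian_const_mul]
    ring

lemma eventuallyEq_onEdge_interp (e : E) {t : ℝ} (ht : t ∈ Ioo 0 (Γ.len e)) :
    Γ.onEdge (interp F) e =ᶠ[𝓝 t]
      fun s => F (Γ.src e) + (F (Γ.tgt e) - F (Γ.src e)) / Γ.len e * s := by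
  filter_upwards [Icc_mem_nhds ht.1 ht.2] with s hs using interp_point F e hs

lemma continuous_interp : Continuous (interp (Γ := Γ) F) :=
  continuous_of_eqOn_edge fun e => ⟨_, by fun_prop, fun _ ht => interp_point F e ht⟩

lemma piecewiseAffine_interp : Γ.PiecewiseAffine (interp F) :=
  ⟨continuous_interp F, ∅, finite_empty, fun e _ ht _ =>
    deriv_deriv_eq_zero_of_eventuallyEq (eventuallyEq_onEdge_interp F e ht)⟩

lemma slopeSum_interp_vertex [Fintype E] (v : V) :
    -Γ.slopeSum (interp F) (.vertex v) = Γ.laplacian F v :=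
  slopeSum_vertex_of_affine F (fun e _ ht => interp_point F e ht) v

lemma slopeSum_interior_of_eventuallyEq [Fintype E] {f : Γ.Point → ℝ} {e : E} {t a b : ℝ}
    (ht : t ∈ Ioo 0 (Γ.len e)) (h : Γ.onEdge f e =ᶠ[𝓝 t] fun s => a + b * s) :
    Γ.slopeSum f (.interior e t ht) = 0 := by
  have hd : HasDerivAt (Γ.onEdge f e) b t := by
    refine HasDerivAt.congr_of_eventuallyEq ?_ h
    simpa using ((hasDerivAt_id t).const_mul b).const_add a
  simp only [slopeSum]
  rw [hd.hasDerivWithinAt.derivWithin (uniqueDiffWithinAt_Ici _),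
    hd.hasDerivWithinAt.derivWithin (uniqueDiffWithinAt_Iic _), sub_self]

lemma slopeSum_interp_interior [Fintype E] {e : E} {t : ℝ} (ht : t ∈ Ioo 0 (Γ.len e)) :
    Γ.slopeSum (interp F) (.interior e t ht) = 0 :=
  slopeSum_interior_of_eventuallyEq ht (eventuallyEq_onEdge_interp F e ht)

end interp

open Classical in
/-- The Green function of the Laplacian on the edges with value `0` at the vertices. -/
noncomputable def tent : Γ.Point → Γ.Point → ℝ
  | .interior e s _, .interior e' t _ =>
      if e = e' then min s t * (Γ.len e - max s t) / Γ.len e else 0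
  | _, _ => 0

section tent

@[simp] lemma tent_vertex_left (v : V) (y : Γ.Point) : tent (.vertex v) y = 0 := rfl

@[simp] lemma tent_vertex_right (x : Γ.Point) (v : V) : tent x (.vertex v) = 0 := by
  cases x <;> rfl

lemma tent_comm (x y : Γ.Point) : tent x y = tent y x := by
  cases x with
  | vertex v => simp
  | interior e s hs =>
    cases y with
    | vertex w => simp
    | interior e' t ht =>
      by_cases h : e = e'
      · subst h
        simp only [tent, min_comm, max_comm]
      · simp only [tent, if_neg h, if_neg (Ne.symm h)]

lemma tent_point_of_ne {e e' : E} (h : e ≠ e') (s : ℝ) {t : ℝ} (ht : t ∈ Ioo 0 (Γ.len e')) :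
    tent (Γ.point e s) (.interior e' t ht) = 0 := by
  by_cases hs : s ∈ Ioo 0 (Γ.len e)
  · simp [Γ.point_of_mem_Ioo hs, tent, h]
  · rw [point, dif_neg hs]
    split_ifs <;> simp

lemma tent_point_of_eq {e : E} {s t : ℝ} (hs : s ∈ Icc 0 (Γ.len e)) (ht : t ∈ Ioo 0 (Γ.len e)) :
    tent (Γ.point e s) (.interior e t ht) = min s t * (Γ.len e - max s t) / Γ.len e := by
  rcases eq_or_lt_of_le hs.1 with rfl | h0
  · simp [point_zero, ht.1.le]
  rcases eq_or_lt_of_le hs.2 with rfl | h1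
  · simp [point_len, ht.2.le]
  · simp [Γ.point_of_mem_Ioo ⟨h0, h1⟩, tent]

lemma tent_point_of_le {e : E} {s t : ℝ} (hs : s ∈ Icc 0 t) (ht : t ∈ Ioo 0 (Γ.len e)) :
    tent (Γ.point e s) (.interior e t ht) = (Γ.len e - t) / Γ.len e * s := by
  rw [tent_point_of_eq ⟨hs.1, hs.2.trans ht.2.le⟩, min_eq_left hs.2, max_eq_right hs.2]
  ring

lemma tent_point_of_ge {e : E} {s t : ℝ} (hs : s ∈ Icc t (Γ.len e)) (ht : t ∈ Ioo 0 (Γ.len e)) :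
    tent (Γ.point e s) (.interior e t ht) = t + -(t / Γ.len e) * s := by
  rw [tent_point_of_eq ⟨ht.1.le.trans hs.1, hs.2⟩, min_eq_right hs.1, max_eq_left hs.1, mul_sub,
    sub_div, mul_div_cancel_right₀ _ (Γ.len_pos e).ne']
  ring

lemma continuous_tent (y : Γ.Point) : Continuous fun x => tent x y := by
  cases y with
  | vertex v => simpa using continuous_const
  | interior e t ht =>
    refine continuous_of_eqOn_edge fun e' => ?_
    by_cases h : e' = e
    · subst h
      exact ⟨_, by fun_prop, fun s hs => tent_point_of_eq hs ht⟩
    · exact ⟨_, continuous_const, fun s _ => tent_point_of_ne h s ht⟩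

lemma eventuallyEq_onEdge_tent (e : E) {s : ℝ} (hs : s ∈ Ioo 0 (Γ.len e)) {y : Γ.Point}
    (hy : Γ.point e s ≠ y) :
    ∃ a b, Γ.onEdge (fun x => tent x y) e =ᶠ[𝓝 s] fun s => a + b * s := by
  cases y with
  | vertex v => exact ⟨0, 0, .of_forall fun s => by simp [onEdge]⟩
  | interior e' t ht =>
    by_cases h : e = e'
    · subst h
      have hst : s ≠ t := by
        rintro rfl
        exact hy (Γ.point_of_mem_Ioo hs)
      rcases lt_or_gt_of_ne hst with hst | hst
      · refine ⟨0, (Γ.len e - t) / Γ.len e, ?_⟩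
        filter_upwards [Icc_mem_nhds hs.1 hst] with u hu
        rw [onEdge, tent_point_of_le hu, zero_add]
      · refine ⟨t, -(t / Γ.len e), ?_⟩
        filter_upwards [Icc_mem_nhds hst hs.2] with u hu using tent_point_of_ge hu ht
    · exact ⟨0, 0, .of_forall fun s => by simp [onEdge, tent_point_of_ne h]⟩

lemma piecewiseAffine_tent (y : Γ.Point) : Γ.PiecewiseAffine fun x => tent x y := by
  refine ⟨continuous_tent y, {y}, finite_singleton y, fun e s hs hy => ?_⟩
  obtain ⟨a, b, h⟩ := eventuallyEq_onEdge_tent e hs hy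
  exact deriv_deriv_eq_zero_of_eventuallyEq h

variable [Fintype E]

open Classical in
lemma slopeSum_tent_interior {e : E} {s : ℝ} (hs : s ∈ Ioo 0 (Γ.len e)) (y : Γ.Point) :
    -Γ.slopeSum (fun x => tent x y) (.interior e s hs)
      = if Point.interior e s hs = y then 1 else 0 := by
  split_ifs with h
  · subst h
    have hL := Γ.len_pos e
    simp only [slopeSum]
    rw [(hasDerivWithinAt_Ici_of_slope (m := -(s / Γ.len e)) hs.2 fun u hu => ?_).derivWithin
        (uniqueDiffWithinAt_Ici _),
      (hasDerivWithinAt_Iic_of_slope (m := (Γ.len e - s) / Γ.len e) hs.1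
        fun u hu => ?_).derivWithin (uniqueDiffWithinAt_Iic _)]
    · field_simp
      ring
    · simp only [onEdge]
      rw [tent_point_of_le hu, tent_point_of_le ⟨hs.1.le, le_rfl⟩]
      ring
    · simp only [onEdge]
      rw [tent_point_of_ge hu, tent_point_of_ge ⟨le_rfl, hs.2.le⟩]
      ring
  · rw [← Γ.point_of_mem_Ioo hs] at h
    obtain ⟨a, b, h⟩ := eventuallyEq_onEdge_tent e hs h
    rw [slopeSum_interior_of_eventuallyEq hs h, neg_zero]

-- The slopes of the tent at the two ends of the edge of `y` carry the unit mass of `y`, distributed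
-- by linear interpolation: the Laplacian of the tent is δ_y minus its sweeping onto the vertices.
open Classical in
lemma slopeSum_tent_vertex (v : V) (y : Γ.Point) :
    -Γ.slopeSum (fun x => tent x y) (.vertex v)
      = (if Point.vertex v = y then 1 else 0) - interp (fun w => if v = w then 1 else 0) y := by
  cases y with
  | vertex w =>
    simp only [tent_vertex_right, PiecewiseAffine.slopeSum_const, interp_vertex, Point.vertex.injEq]
    simp
  | interior e t ht =>
    have hL := Γ.len_pos e
    simp only [slopeSum, reduceCtorEq, if_false, zero_sub, neg_inj]
    rw [Finset.sum_eq_single e]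
    · rw [(hasDerivWithinAt_Ici_of_slope (m := (Γ.len e - t) / Γ.len e) ht.1
          fun u hu => ?_).derivWithin (uniqueDiffWithinAt_Ici _),
        (hasDerivWithinAt_Iic_of_slope (m := -(t / Γ.len e)) ht.2 fun u hu => ?_).derivWithin
          (uniqueDiffWithinAt_Iic _)]
      · simp only [interp, eq_comm (a := v)]
        split_ifs <;> field_simp <;> ring
      · simp only [onEdge]
        rw [tent_point_of_ge hu, tent_point_of_ge ⟨ht.2.le, le_rfl⟩]
        ring
      · simp only [onEdge]
        rw [tent_point_of_le hu, tent_point_of_le ⟨le_rfl, ht.1.le⟩]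
        ring
    · intro e' _ h
      have : Γ.onEdge (fun x => tent x (.interior e t ht)) e' = fun _ => 0 := by
        ext s
        exact tent_point_of_ne h s ht
      simp [this]
    · simp

end tent

/-- The Green function of the metrized graph with value `0` at the vertex at which `G` is
grounded. -/
noncomputable def green (G : V → V → ℝ) (x y : Γ.Point) : ℝ :=
  tent x y + interp (fun v => interp (G v) y) x

section green

variable {G : V → V → ℝ} {o : V}

lemma continuous_green (G : V → V → ℝ) (y : Γ.Point) : Continuous fun x => green G x y :=
  (continuous_tent y).add (continuous_interp _)

/-- Rewritten as a difference so that `PiecewiseAffine.sub` and `PiecewiseAffine.slopeSum_sub`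
apply. -/
lemma green_eq (G : V → V → ℝ) (y : Γ.Point) :
    (fun x => green G x y) = fun x => tent x y - interp (fun v => -interp (G v) y) x := by
  ext x
  have := interp_sub (Γ := Γ) (fun _ => 0) (fun v => interp (G v) y) x
  simp only [zero_sub, interp_const] at this
  rw [this, green, sub_neg_eq_add]

lemma piecewiseAffine_green (G : V → V → ℝ) (y : Γ.Point) :
    Γ.PiecewiseAffine fun x => green G x y := by
  rw [green_eq]
  exact (piecewiseAffine_tent y).sub (piecewiseAffine_interp _)

variable [Fintype E] [Fintype V]

lemma IsGreen.green_comm (hG : Γ.IsGreen o G) (x y : Γ.Point) : green G x y = green G y x := by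
  rw [green, green, tent_comm, interp_interp_comm]
  simp only [hG.symm]

-- The tent leaves minus the swept mass of `y` at the vertices; the interpolated part has Laplacian
-- equal to this swept mass minus δ_o, so the swept mass cancels.
open Classical in
lemma IsGreen.slopeSum_green (hG : Γ.IsGreen o G) (y p : Γ.Point) :
    -Γ.slopeSum (fun x => green G x y) p
      = (if p = y then 1 else 0) - (if p = .vertex o then 1 else 0) := by
  rw [green_eq, (piecewiseAffine_tent y).slopeSum_sub (piecewiseAffine_interp _), neg_sub]
  cases p with
  | vertex v =>
    have h1 := slopeSum_tent_vertex v y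
    have h2 := slopeSum_interp_vertex (Γ := Γ) (fun v => -interp (G v) y) v
    have h3 := Γ.laplacian_const_mul (-1) (fun v => interp (G v) y) v
    simp only [neg_one_mul] at h3
    rw [h3, laplacian_interp] at h2
    simp only [fun w => funext fun u => hG.symm u w, hG.laplacian, interp_sub, interp_const] at h2
    simp only [Point.vertex.injEq]
    linarith
  | interior e t ht =>
    rw [slopeSum_interp_interior, zero_sub, slopeSum_tent_interior]
    simp

/-- Subtracting the Green function with pole `z` cancels the sinks at `o`; the constant normalizes
the value at `z`. -/
theorem IsGreen.isVoltage (hG : Γ.IsGreen o G) (z y : Γ.Point) :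
    Γ.IsVoltage z y fun x => green G x y - green G x z - (green G z y - green G z z) := by
  have hyz := (piecewiseAffine_green G y).sub (piecewiseAffine_green G z)
  have h := hyz.sub (.const (green G z y - green G z z))
  refine ⟨h.continuous, sub_self _, h.second_deriv, fun p => ?_⟩
  rw [hyz.slopeSum_sub (.const _), PiecewiseAffine.slopeSum_const,
    (piecewiseAffine_green G y).slopeSum_sub (piecewiseAffine_green G z)]
  linarith [hG.slopeSum_green y p, hG.slopeSum_green z p]

theorem IsGreen.voltage_eq (hG : Γ.IsGreen o G) (hΓ : Γ.Connected) (z x y : Γ.Point) :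
    Γ.voltage z x y = green G x y - green G x z - (green G z y - green G z z) :=
  (hG.isVoltage z y).voltage_eq hΓ x

end green

end MetrizedGraph

/-! ### The canonical measure as an explicit functional, and the value of the tau constant. -/

lemma integral_add_mul (a b p q : ℝ) :
    ∫ t in a..b, (p + q * t) = p * (b - a) + q * ((b ^ 2 - a ^ 2) / 2) := by
  rw [intervalIntegral.integral_add (by simp) (by apply Continuous.intervalIntegrable; fun_prop)]
  rw [intervalIntegral.integral_const, intervalIntegral.integral_const_mul, integral_id, smul_eq_mul]
  ring

namespace MetrizedGraph

variable {V E : Type*} {Γ : MetrizedGraph V E}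

/-- The density `(1 - r / len e) / len e` of the canonical measure along the edge `e`, where `r` is
the effective resistance between the end points of `e`, read off from a Green function. -/
noncomputable def edgeDensity (Γ : MetrizedGraph V E) (G : V → V → ℝ) (e : E) : ℝ :=
  (1 - (G (Γ.src e) (Γ.src e) - 2 * G (Γ.src e) (Γ.tgt e) + G (Γ.tgt e) (Γ.tgt e)) / Γ.len e)
    / Γ.len e

open Classical in
/-- The masses of the vertices in the canonical measure. -/
noncomputable def vertexMass [Fintype E] (Γ : MetrizedGraph V E) (o : V) (G : V → V → ℝ) (v : V) :
    ℝ :=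
  (if v = o then 1 else 0) + 1 / 2 * Γ.laplacian (fun v => G v v) v
    - ∑ e, ((if Γ.src e = v then Γ.edgeDensity G e * Γ.len e / 2 else 0)
      + (if Γ.tgt e = v then Γ.edgeDensity G e * Γ.len e / 2 else 0))

/-- Integration against the canonical measure, which has the point mass `vertexMass` at each
vertex and the constant density `edgeDensity` along each edge. -/
noncomputable def canonicalIntegral [Fintype V] [Fintype E] (Γ : MetrizedGraph V E) (o : V)
    (G : V → V → ℝ) (f : Γ.Point → ℝ) : ℝ :=
  ∑ v, Γ.vertexMass o G v * f (.vertex v)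
    + ∑ e, Γ.edgeDensity G e * ∫ t in (0 : ℝ)..Γ.len e, f (Γ.point e t)

/-- On the diagonal, bilinear interpolation falls short of affine interpolation by r t(L - t)/L²,
while the tent adds t(L - t)/L. The net coefficient of t(L - t) is the density. -/
lemma IsGreen.green_self [Fintype E] [Fintype V] {o : V} {G : V → V → ℝ} (hG : Γ.IsGreen o G)
    (e : E) {t : ℝ} (ht : t ∈ Icc 0 (Γ.len e)) :
    green G (Γ.point e t) (Γ.point e t) = interp (fun v => G v v) (Γ.point e t)
      + Γ.edgeDensity G e * (t * (Γ.len e - t)) := by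
  have htent : tent (Γ.point e t) (Γ.point e t) = t * (Γ.len e - t) / Γ.len e := by
    rcases eq_or_lt_of_le ht.1 with rfl | h0
    · simp [point_zero]
    rcases eq_or_lt_of_le ht.2 with rfl | h1
    · simp [point_len]
    · simp [Γ.point_of_mem_Ioo ⟨h0, h1⟩, tent]
  have hL := (Γ.len_pos e).ne'
  rw [green, htent, interp_point _ e ht, interp_point _ e ht, interp_point _ e ht,
    interp_point _ e ht, hG.symm (Γ.tgt e) (Γ.src e), edgeDensity]
  field_simp
  ring

lemma intervalIntegrable_comp_point {f : Γ.Point → ℝ} (hf : Continuous f) (e : E) (a b : ℝ) :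
    IntervalIntegrable (fun t => f (Γ.point e t)) volume a b :=
  (hf.comp (Γ.continuous_point e)).intervalIntegrable a b

lemma integral_tent_interior_self {e : E} {s : ℝ} (hs : s ∈ Ioo 0 (Γ.len e)) :
    ∫ t in (0 : ℝ)..Γ.len e, tent (Γ.point e t) (.interior e s hs) = s * (Γ.len e - s) / 2 := by
  have hL := (Γ.len_pos e).ne'
  have hint : ∀ a b, IntervalIntegrable (fun t => tent (Γ.point e t) (.interior e s hs)) volume a b :=
    intervalIntegrable_comp_point (continuous_tent _) e
  rw [← intervalIntegral.integral_add_adjacent_intervals (hint 0 s) (hint s _),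
    intervalIntegral.integral_congr (g := fun t => 0 + (Γ.len e - s) / Γ.len e * t)
      fun t ht => ?_,
    intervalIntegral.integral_congr (a := s) (g := fun t => s + -(s / Γ.len e) * t) fun t ht => ?_,
    integral_add_mul, integral_add_mul]
  · field_simp
    ring
  · rw [uIcc_of_le hs.2.le] at ht
    exact tent_point_of_ge ht hs
  · rw [uIcc_of_le hs.1.le] at ht
    simp only [tent_point_of_le ht hs, zero_add]

lemma integral_interp_point (F : V → ℝ) (e : E) :
    ∫ t in (0 : ℝ)..Γ.len e, interp F (Γ.point e t)
      = Γ.len e / 2 * (F (Γ.src e) + F (Γ.tgt e)) := by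
  have hL := (Γ.len_pos e).ne'
  rw [intervalIntegral.integral_congr (g := fun t =>
    F (Γ.src e) + (F (Γ.tgt e) - F (Γ.src e)) / Γ.len e * t) fun t ht => ?_, integral_add_mul]
  · field_simp
    ring
  · rw [uIcc_of_le (Γ.len_pos e).le] at ht
    exact interp_point F e ht

section canonicalIntegral

variable [Fintype V] [Fintype E] {o : V} {G : V → V → ℝ}

/-- The last term of `vertexMass` removes from the vertices what the trapezoidal rule assigns to the
edges, so only the error `k e` of that rule on each edge survives. -/
lemma canonicalIntegral_eq {f : Γ.Point → ℝ} {F : V → ℝ} {k : E → ℝ}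
    (hv : ∀ v, f (.vertex v) = F v)
    (he : ∀ e, ∫ t in (0 : ℝ)..Γ.len e, f (Γ.point e t)
      = Γ.len e / 2 * (F (Γ.src e) + F (Γ.tgt e)) + k e) :
    Γ.canonicalIntegral o G f = F o + 1 / 2 * ∑ v, F v * Γ.laplacian (fun v => G v v) v
      + ∑ e, Γ.edgeDensity G e * k e := by
  classical
  have h1 : ∑ v, (∑ e, ((if Γ.src e = v then Γ.edgeDensity G e * Γ.len e / 2 else 0)
      + (if Γ.tgt e = v then Γ.edgeDensity G e * Γ.len e / 2 else 0))) * F v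
      = ∑ e, Γ.edgeDensity G e * (Γ.len e / 2 * (F (Γ.src e) + F (Γ.tgt e))) := by
    simp only [Finset.sum_mul]
    rw [Finset.sum_comm]
    refine Finset.sum_congr rfl fun e _ => ?_
    simp only [add_mul, ite_mul, zero_mul, Finset.sum_add_distrib, Finset.sum_ite_eq,
      Finset.mem_univ, if_true]
    ring
  have h2 : ∑ v, Γ.vertexMass o G v * F v
      = F o + 1 / 2 * ∑ v, F v * Γ.laplacian (fun v => G v v) v
        - ∑ e, Γ.edgeDensity G e * (Γ.len e / 2 * (F (Γ.src e) + F (Γ.tgt e))) := by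
    rw [← h1, Finset.mul_sum]
    simp only [vertexMass, sub_mul, add_mul, Finset.sum_sub_distrib, Finset.sum_add_distrib,
      ite_mul, one_mul, zero_mul, Finset.sum_ite_eq', Finset.mem_univ, if_true]
    congr 2
    exact Finset.sum_congr rfl fun v _ => by ring
  simp only [canonicalIntegral, hv, he, h2, mul_add, Finset.sum_add_distrib]
  ring

lemma canonicalIntegral_sub {f g : Γ.Point → ℝ} (hf : Continuous f) (hg : Continuous g) :
    Γ.canonicalIntegral o G (fun x => f x - g x)
      = Γ.canonicalIntegral o G f - Γ.canonicalIntegral o G g := by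
  have h : ∀ e, ∫ t in (0 : ℝ)..Γ.len e, (f (Γ.point e t) - g (Γ.point e t))
      = (∫ t in (0 : ℝ)..Γ.len e, f (Γ.point e t)) - ∫ t in (0 : ℝ)..Γ.len e, g (Γ.point e t) :=
    fun e => intervalIntegral.integral_sub
      (intervalIntegrable_comp_point hf e _ _) (intervalIntegrable_comp_point hg e _ _)
  simp only [canonicalIntegral, h, mul_sub, Finset.sum_sub_distrib]
  ring

lemma canonicalIntegral_const (c : ℝ) : Γ.canonicalIntegral o G (fun _ => c) = c := by
  rw [canonicalIntegral_eq (F := fun _ => c) (k := fun _ => 0) (fun _ => rfl) fun e => by simp; ring,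
    ← Finset.mul_sum, sum_laplacian]
  simp

variable (hG : Γ.IsGreen o G)
include hG

lemma IsGreen.interp_sum_mul_laplacian (F : V → ℝ) (x : Γ.Point) :
    ∑ v, interp (fun u => G u v) x * Γ.laplacian F v = interp F x - F o := by
  cases x with
  | vertex w => exact hG.sum_mul_laplacian F w
  | interior e t ht =>
    have h1 := hG.sum_mul_laplacian F (Γ.src e)
    have h2 := hG.sum_mul_laplacian F (Γ.tgt e)
    have h : ∀ v, interp (fun u => G u v) (.interior e t ht) * Γ.laplacian F v
        = (1 - t / Γ.len e) * (G (Γ.src e) v * Γ.laplacian F v)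
          + t / Γ.len e * (G (Γ.tgt e) v * Γ.laplacian F v) := fun v => by
      simp only [interp]
      ring
    simp only [h, Finset.sum_add_distrib, ← Finset.mul_sum, h1, h2]
    simp only [interp]
    ring

/-- The Laplacian of the diagonal in `vertexMass` reproduces half of the interpolated diagonal. On
the edge containing `x`, the integral s(L - s)/2 of the tent, weighted by the density, is half of
the quadratic term in `IsGreen.green_self`. -/
lemma IsGreen.canonicalIntegral_green (x : Γ.Point) :
    Γ.canonicalIntegral o G (fun y => green G y x) = 1 / 2 * green G x x := by
  have hsym : ∀ v, G v = fun u => G u v := fun v => funext fun u => hG.symm v u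
  have hv : ∀ v, green G (.vertex v) x = interp (fun u => G u v) x := fun v => by
    rw [green, tent_vertex_left, zero_add, interp_vertex, hsym]
  have he : ∀ e, ∫ t in (0 : ℝ)..Γ.len e, green G (Γ.point e t) x
      = Γ.len e / 2 * (interp (fun u => G u (Γ.src e)) x + interp (fun u => G u (Γ.tgt e)) x)
        + ∫ t in (0 : ℝ)..Γ.len e, tent (Γ.point e t) x := fun e => by
    simp only [green]
    rw [intervalIntegral.integral_add
      (intervalIntegrable_comp_point (continuous_tent x) e _ _)
      (intervalIntegrable_comp_point (continuous_interp _) e _ _),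
      integral_interp_point, add_comm, hsym, hsym (Γ.tgt e)]
  rw [canonicalIntegral_eq (F := fun v => interp (fun u => G u v) x) hv he,
    hG.interp_sum_mul_laplacian, hG.ground]
  simp only [hG.ground, interp_const]
  cases x with
  | vertex v => simp [green]
  | interior e s hs =>
    rw [Finset.sum_eq_single e, integral_tent_interior_self,
      ← Γ.point_of_mem_Ioo hs, hG.green_self e ⟨hs.1.le, hs.2.le⟩]
    · ring
    · intro e' _ h
      simp [tent_point_of_ne h]
    · simp

/-- Twice the tau constant. -/
lemma IsGreen.canonicalIntegral_green_self :
    Γ.canonicalIntegral o G (fun x => green G x x)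
      = 1 / 2 * ∑ e, (G (Γ.src e) (Γ.src e) - G (Γ.tgt e) (Γ.tgt e)) ^ 2 / Γ.len e
        + 1 / 6 * ∑ e, Γ.edgeDensity G e ^ 2 * Γ.len e ^ 3 := by
  have he : ∀ e, ∫ t in (0 : ℝ)..Γ.len e, green G (Γ.point e t) (Γ.point e t)
      = Γ.len e / 2 * (G (Γ.src e) (Γ.src e) + G (Γ.tgt e) (Γ.tgt e))
        + Γ.edgeDensity G e * (Γ.len e ^ 3 / 6) := fun e => by
    rw [intervalIntegral.integral_congr (g := fun t => interp (fun v => G v v) (Γ.point e t)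
      + Γ.edgeDensity G e * (t * (Γ.len e - t))) fun t ht => ?_,
      intervalIntegral.integral_add
        (intervalIntegrable_comp_point (continuous_interp _) e _ _)
        (by apply Continuous.intervalIntegrable; fun_prop),
      integral_interp_point, intervalIntegral.integral_const_mul]
    · simp only [mul_sub, ← pow_two]
      rw [intervalIntegral.integral_sub (by apply Continuous.intervalIntegrable; fun_prop)
        (by apply Continuous.intervalIntegrable; fun_prop), integral_pow,
        intervalIntegral.integral_mul_const, integral_id]
      push_cast
      ring
    · rw [uIcc_of_le (Γ.len_pos e).le] at ht
      exact hG.green_self e ht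
  -- With the diagonal as `F`, the vertex term is the Dirichlet energy of the diagonal; the error of
  -- the trapezoidal rule is the density times ∫ t(L - t) dt = L³/6.
  rw [canonicalIntegral_eq (F := fun v => G v v) (fun v => by simp [green]) he,
    Γ.sum_mul_laplacian, hG.ground, zero_add, Finset.mul_sum _ _ (1 / 6 : ℝ)]
  congr 1
  · congr 1
    exact Finset.sum_congr rfl fun e _ => by ring
  · exact Finset.sum_congr rfl fun e _ => by ring

lemma IsGreen.continuous_green_self : Continuous fun x : Γ.Point => green G x x :=
  continuous_of_eqOn_edge fun e => ⟨fun t => G (Γ.src e) (Γ.src e)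
      + (G (Γ.tgt e) (Γ.tgt e) - G (Γ.src e) (Γ.src e)) / Γ.len e * t
      + Γ.edgeDensity G e * (t * (Γ.len e - t)), by fun_prop, fun t ht => by
    rw [hG.green_self e ht, interp_point _ e ht]⟩

/-- The effective resistance between two points in terms of a Green function. -/
lemma IsGreen.voltage_self (hΓ : Γ.Connected) (z x : Γ.Point) :
    Γ.voltage z x x = green G x x - green G z x - (green G z x - green G z z) := by
  rw [hG.voltage_eq hΓ, hG.green_comm x z]

lemma IsGreen.continuous_voltage_self_left (hΓ : Γ.Connected) (x : Γ.Point) :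
    Continuous fun z => Γ.voltage z x x := by
  simp only [hG.voltage_self hΓ]
  exact (continuous_const.sub (continuous_green G x)).sub
    ((continuous_green G x).sub hG.continuous_green_self)

lemma IsGreen.voltage_self_comm (hΓ : Γ.Connected) (z x : Γ.Point) :
    Γ.voltage z x x = Γ.voltage x z z := by
  rw [hG.voltage_self hΓ, hG.voltage_self hΓ, hG.green_comm x z]
  ring

/-- The two mixed Green terms integrate to g(x,x)/2 each and cancel g(x,x), since the total mass is
one. -/
lemma IsGreen.canonicalIntegral_voltage_self (hΓ : Γ.Connected) (x : Γ.Point) :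
    Γ.canonicalIntegral o G (fun z => Γ.voltage z x x)
      = Γ.canonicalIntegral o G (fun x => green G x x) := by
  have hc := continuous_green G x
  simp only [hG.voltage_self hΓ]
  rw [canonicalIntegral_sub (f := fun z => green G x x - green G z x)
      (g := fun z => green G z x - green G z z)
      (continuous_const.sub hc) (hc.sub hG.continuous_green_self),
    canonicalIntegral_sub continuous_const hc, canonicalIntegral_sub hc hG.continuous_green_self,
    canonicalIntegral_const, hG.canonicalIntegral_green]
  ring

end canonicalIntegral

end MetrizedGraph

/-! ### Integration against signed measures. -/

namespace MeasureTheory.SignedMeasure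

variable {X : Type*} [MeasurableSpace X]

lemma isFiniteMeasure_variation (μ : SignedMeasure X) : IsFiniteMeasure μ.variation := by
  rw [← totalVariation_eq_variation, totalVariation]
  infer_instance

lemma integral_toSignedMeasure_lsmul (μ : Measure X) [IsFiniteMeasure μ] (f : X → ℝ) :
    ∫ᵛ x, f x ∂•μ.toSignedMeasure = ∫ x, f x ∂μ := by
  have h : ContinuousLinearMap.lsmul ℝ ℝ = (ContinuousLinearMap.lsmul ℝ ℝ (E := ℝ)).flip := by
    ext
    simp
  rw [h, VectorMeasure.integral_toSignedMeasure]

lemma integral_eq_sub (μ : SignedMeasure X) {f : X → ℝ} (hf : μ.Integrable f) :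
    ∫ᵛ x, f x ∂•μ = ∫ x, f x ∂μ.toJordanDecomposition.posPart
      - ∫ x, f x ∂μ.toJordanDecomposition.negPart := by
  rw [VectorMeasure.Integrable, ← totalVariation_eq_variation, totalVariation,
    integrable_add_measure] at hf
  conv_lhs => rw [← μ.toSignedMeasure_toJordanDecomposition, JordanDecomposition.toSignedMeasure]
  rw [VectorMeasure.integral_sub_vectorMeasure, integral_toSignedMeasure_lsmul,
    integral_toSignedMeasure_lsmul]
  · simpa [VectorMeasure.Integrable] using hf.1
  · simpa [VectorMeasure.Integrable] using hf.2

lemma integrable_of_abs_le (μ : SignedMeasure X) {f : X → ℝ} (hf : StronglyMeasurable f) {C : ℝ}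
    (h : ∀ x, |f x| ≤ C) : μ.Integrable f := by
  have := μ.isFiniteMeasure_variation
  exact Integrable.of_bound hf.aestronglyMeasurable C (.of_forall h)

lemma stronglyMeasurable_intervalIntegral {h : ℝ → X → ℝ} (hcont : ∀ x, Continuous fun t => h t x)
    (hmeas : ∀ t, StronglyMeasurable (h t)) (a b : ℝ) :
    StronglyMeasurable fun x => ∫ t in a..b, h t x := by
  have hm := stronglyMeasurable_uncurry_of_continuous_of_stronglyMeasurable hcont hmeas
  simp only [intervalIntegral.intervalIntegral_eq_integral_uIoc, smul_eq_mul]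
  exact StronglyMeasurable.const_mul
    (hm.integral_prod_left (μ := volume.restrict (uIoc a b))) (if a ≤ b then 1 else -1)

/-- The Jordan decomposition reduces this to Fubini for finite positive measures. Joint
measurability comes from continuity in `t` and measurability in `x`. -/
lemma integral_intervalIntegral_comm (μ : SignedMeasure X) {h : ℝ → X → ℝ}
    (hcont : ∀ x, Continuous fun t => h t x) (hmeas : ∀ t, StronglyMeasurable (h t)) {C : ℝ}
    (hC : ∀ t x, |h t x| ≤ C) (a b : ℝ) :
    ∫ᵛ x, (∫ t in a..b, h t x) ∂•μ = ∫ t in a..b, ∫ᵛ x, h t x ∂•μ := by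
  have hm := stronglyMeasurable_uncurry_of_continuous_of_stronglyMeasurable hcont hmeas
  have hb : ∀ x, |∫ t in a..b, h t x| ≤ C * |b - a| := fun x => by
    rw [← Real.norm_eq_abs]
    exact intervalIntegral.norm_integral_le_of_norm_le_const fun t _ => hC t x
  have hint : ∀ (ν : Measure X) [IsFiniteMeasure ν],
      Integrable (Function.uncurry h) ((volume.restrict (uIoc a b)).prod ν) := fun ν _ => by
    have : IsFiniteMeasure ((volume : Measure ℝ).restrict (uIoc a b)) := by
      rw [uIoc]
      infer_instance
    exact Integrable.of_bound hm.aestronglyMeasurable C (.of_forall fun p => hC p.1 p.2)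
  have hswap : ∀ (ν : Measure X) [IsFiniteMeasure ν],
      ∫ x, (∫ t in a..b, h t x) ∂ν = ∫ t in a..b, ∫ x, h t x ∂ν :=
    fun ν _ => (intervalIntegral_integral_swap (hint ν)).symm
  have hII : ∀ (ν : Measure X) [IsFiniteMeasure ν],
      IntervalIntegrable (fun t => ∫ x, h t x ∂ν) volume a b := fun ν _ => by
    rw [intervalIntegrable_iff]
    exact (hint ν).integral_prod_left
  have hsm := stronglyMeasurable_intervalIntegral hcont hmeas a b
  rw [μ.integral_eq_sub (μ.integrable_of_abs_le hsm hb), hswap, hswap,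
    ← intervalIntegral.integral_sub (hII _) (hII _)]
  refine intervalIntegral.integral_congr fun t _ => ?_
  exact (μ.integral_eq_sub (μ.integrable_of_abs_le (hmeas t) (hC t))).symm

end MeasureTheory.SignedMeasure

/-! ### The canonical measure as a signed measure, and well-definedness of the tau constant. -/

namespace MetrizedGraph

variable {V E : Type*} {Γ : MetrizedGraph V E}

lemma integrable_of_continuous [Finite V] [Finite E] (μ : SignedMeasure Γ.Point)
    {f : Γ.Point → ℝ} (hf : Continuous f) : μ.Integrable f := by
  obtain ⟨C, hC⟩ := exists_abs_le_of_continuous hf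
  exact μ.integrable_of_abs_le hf.stronglyMeasurable hC

lemma abs_interp_le [Fintype V] (F : V → ℝ) (x : Γ.Point) : |interp F x| ≤ ∑ v, |F v| := by
  have h : ∀ v, |F v| ≤ ∑ v, |F v| := fun v =>
    Finset.single_le_sum (fun v _ => abs_nonneg (F v)) (Finset.mem_univ v)
  cases x with
  | vertex v => exact h v
  | interior e t ht =>
    have hL := Γ.len_pos e
    have ht0 : 0 ≤ t / Γ.len e := div_nonneg ht.1.le hL.le
    have ht1 : t / Γ.len e ≤ 1 := (div_le_one hL).2 ht.2.le
    have h1 := abs_le.1 (h (Γ.src e))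
    have h2 := abs_le.1 (h (Γ.tgt e))
    have : interp F (.interior e t ht)
        = (1 - t / Γ.len e) * F (Γ.src e) + t / Γ.len e * F (Γ.tgt e) := by
      simp only [interp]
      ring
    rw [this, abs_le]
    constructor <;> nlinarith

lemma abs_tent_le [Fintype E] (x y : Γ.Point) : |tent x y| ≤ ∑ e, Γ.len e := by
  have h0 : 0 ≤ ∑ e, Γ.len e := Finset.sum_nonneg fun e _ => (Γ.len_pos e).le
  cases x with
  | vertex v => simpa
  | interior e s hs =>
    cases y with
    | vertex w => simpa
    | interior e' t ht =>
      by_cases h : e = e'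
      · subst h
        have hL := Γ.len_pos e
        have h1 : 0 ≤ min s t := le_min hs.1.le ht.1.le
        have h2 : min s t ≤ Γ.len e := (min_le_left _ _).trans hs.2.le
        have h3 : max s t ≤ Γ.len e := max_le hs.2.le ht.2.le
        have h4 : 0 ≤ max s t := hs.1.le.trans (le_max_left _ _)
        simp only [tent, if_true]
        rw [abs_of_nonneg (div_nonneg (mul_nonneg h1 (sub_nonneg.2 h3)) hL.le), div_le_iff₀ hL]
        refine le_trans (b := Γ.len e * Γ.len e) ?_ ?_
        · exact mul_le_mul h2 (by linarith) (by linarith) hL.le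
        · exact mul_le_mul_of_nonneg_right
            (Finset.single_le_sum (fun e _ => (Γ.len_pos e).le) (Finset.mem_univ e)) hL.le
      · simpa [tent, h]

variable [Fintype V] [Fintype E] {o : V} {G : V → V → ℝ}

lemma exists_abs_green_le (G : V → V → ℝ) : ∃ C, ∀ x y : Γ.Point, |green G x y| ≤ C := by
  refine ⟨∑ e, Γ.len e + ∑ v, ∑ w, |G v w|, fun x y => (abs_add_le _ _).trans ?_⟩
  refine add_le_add (abs_tent_le x y) ((abs_interp_le _ x).trans ?_)
  exact Finset.sum_le_sum fun v _ => abs_interp_le _ y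

/-- The canonical measure. -/
noncomputable def canonicalMeasure (Γ : MetrizedGraph V E) (o : V) (G : V → V → ℝ) :
    SignedMeasure Γ.Point :=
  ∑ v, VectorMeasure.dirac (.vertex v) (Γ.vertexMass o G v)
    + ∑ e, Γ.edgeDensity G e •
      ((volume.restrict (Ioc 0 (Γ.len e))).map (Γ.point e)).toSignedMeasure

lemma integral_canonicalMeasure {f : Γ.Point → ℝ} (hf : Continuous f) :
    ∫ᵛ x, f x ∂•Γ.canonicalMeasure o G = Γ.canonicalIntegral o G f := by
  have hint : ∀ μ : SignedMeasure Γ.Point, μ.Integrable f := fun μ => integrable_of_continuous μ hf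
  rw [canonicalMeasure, VectorMeasure.integral_add_vectorMeasure (hint _) (hint _),
    VectorMeasure.integral_finsetSum_vectorMeasure fun v _ => hint _,
    VectorMeasure.integral_finsetSum_vectorMeasure fun v _ => hint _, canonicalIntegral]
  congr 1
  · refine Finset.sum_congr rfl fun v _ => ?_
    rw [VectorMeasure.integral_dirac' hf.stronglyMeasurable, ContinuousLinearMap.lsmul_apply,
      smul_eq_mul, mul_comm]
  · refine Finset.sum_congr rfl fun e _ => ?_
    rw [VectorMeasure.integral_smul_vectorMeasure, SignedMeasure.integral_toSignedMeasure_lsmul,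
      integral_map (Γ.continuous_point e).measurable.aemeasurable
        hf.stronglyMeasurable.aestronglyMeasurable, smul_eq_mul,
      intervalIntegral.integral_of_le (Γ.len_pos e).le]

lemma canonicalMeasure_univ : Γ.canonicalMeasure o G univ = 1 := by
  have := (Γ.canonicalMeasure o G).isFiniteMeasure_variation
  have h := integral_canonicalMeasure (Γ := Γ) (o := o) (G := G) (continuous_const (y := (1 : ℝ)))
  rw [canonicalIntegral_const, VectorMeasure.integral_const] at h
  simpa using h

lemma integral_canonicalIntegral_comm (μ : SignedMeasure Γ.Point) {r : Γ.Point → Γ.Point → ℝ}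
    (h1 : ∀ x, Continuous (r x)) (h2 : ∀ y, Continuous fun x => r x y) {C : ℝ}
    (hC : ∀ x y, |r x y| ≤ C) :
    ∫ᵛ y, Γ.canonicalIntegral o G (fun x => r x y) ∂•μ
      = Γ.canonicalIntegral o G fun x => ∫ᵛ y, r x y ∂•μ := by
  have hv : ∀ v ∈ Finset.univ, μ.Integrable fun y => Γ.vertexMass o G v * r (.vertex v) y :=
    fun v _ => (integrable_of_continuous μ (h1 _)).const_mul _
  have he : ∀ e ∈ Finset.univ, μ.Integrable fun y =>
      Γ.edgeDensity G e * ∫ t in (0 : ℝ)..Γ.len e, r (Γ.point e t) y := by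
    intro e _
    refine Integrable.const_mul ?_ _
    refine μ.integrable_of_abs_le ?_ (C := C * |Γ.len e - 0|) fun y => by
      rw [← Real.norm_eq_abs]
      exact intervalIntegral.norm_integral_le_of_norm_le_const fun t _ => hC _ y
    exact SignedMeasure.stronglyMeasurable_intervalIntegral
      (h := fun t y => r (Γ.point e t) y) (fun y => (h2 y).comp (Γ.continuous_point e))
      (fun t => (h1 _).stronglyMeasurable) _ _
  simp only [canonicalIntegral]
  rw [VectorMeasure.integral_fun_add (VectorMeasure.Integrable.fun_finsetSum _ hv)
    (VectorMeasure.Integrable.fun_finsetSum _ he), VectorMeasure.integral_finsetSum _ hv,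
    VectorMeasure.integral_finsetSum _ he]
  congr 1
  · exact Finset.sum_congr rfl fun v _ => VectorMeasure.integral_fun_smul _ _ _ _
  · refine Finset.sum_congr rfl fun e _ => ?_
    rw [← SignedMeasure.integral_intervalIntegral_comm μ
      (h := fun t y => r (Γ.point e t) y) (fun y => (h2 y).comp (Γ.continuous_point e)) (fun t => (h1 _).stronglyMeasurable)
      fun t y => hC _ y]
    exact VectorMeasure.integral_fun_smul _ _ _ _

variable (hG : Γ.IsGreen o G)
include hG

/-- Existence is the canonical measure. For uniqueness, the symmetric kernel j_y(x,x) is integrated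
against an admissible `μ` and the canonical measure: one order gives 2t, the other gives the
canonical constant. -/
theorem IsGreen.isTauConstant_iff (hΓ : Γ.Connected) (t : ℝ) :
    Γ.IsTauConstant t ↔ t = 1 / 2 * Γ.canonicalIntegral o G fun x => green G x x := by
  have hcont := hG.continuous_voltage_self_left hΓ
  constructor
  · rintro ⟨μ, hμ, ht⟩
    obtain ⟨C, hC⟩ := exists_abs_green_le (Γ := Γ) G
    have hC4 : ∀ x y, |Γ.voltage y x x| ≤ 4 * C := fun x y => by
      rw [hG.voltage_self hΓ, abs_le]
      have h1 := abs_le.1 (hC x x)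
      have h2 := abs_le.1 (hC y x)
      have h3 := abs_le.1 (hC y y)
      constructor <;> linarith
    have h := integral_canonicalIntegral_comm (o := o) (G := G) μ
      (r := fun x y => Γ.voltage y x x) (fun x => hcont x)
      (fun y => by simpa only [hG.voltage_self_comm hΓ y] using hcont y) hC4
    have h3 : ∀ x, ∫ᵛ y, Γ.voltage y x x ∂•μ = 2 * t := fun x => by
      have := ht x
      rw [voltageMeasure] at this
      linarith
    simp only [h3, canonicalIntegral_const] at h
    have h4 : ∀ y, Γ.canonicalIntegral o G (fun x => Γ.voltage y x x)
        = Γ.canonicalIntegral o G fun x => green G x x := fun y => by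
      simp only [hG.voltage_self_comm hΓ y, hG.canonicalIntegral_voltage_self hΓ]
    simp only [h4] at h
    have := μ.isFiniteMeasure_variation
    rw [VectorMeasure.integral_const, hμ] at h
    simp at h
    linarith
  · rintro rfl
    refine ⟨Γ.canonicalMeasure o G, canonicalMeasure_univ, fun x => ?_⟩
    rw [voltageMeasure, integral_canonicalMeasure (hcont x), hG.canonicalIntegral_voltage_self hΓ]

end MetrizedGraph

/-! ### The lower bounds. -/

lemma sum_pow_three_div_sq_le {ι : Type*} (s : Finset ι) {a b : ι → ℝ} (ha : ∀ i ∈ s, 0 ≤ a i)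
    (hb : ∀ i ∈ s, 0 < b i) :
    (∑ i ∈ s, a i) ^ 3 / (∑ i ∈ s, b i) ^ 2 ≤ ∑ i ∈ s, a i ^ 3 / b i ^ 2 := by
  rcases s.eq_empty_or_nonempty with rfl | hs
  · simp
  set A := ∑ i ∈ s, a i with hA
  set B := ∑ i ∈ s, b i with hB
  have hB0 : 0 < B := Finset.sum_pos hb hs
  have hk : 0 ≤ A / B := div_nonneg (Finset.sum_nonneg ha) hB0.le
  -- Jensen for x ↦ x³ with weights `b i`, by the tangent at k = A/B: x³ - 3k²x + 2k³ = (x - k)²(x +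
  -- 2k) ≥ 0 at x = a/b.
  calc A ^ 3 / B ^ 2 = 3 * (A / B) ^ 2 * A - 2 * (A / B) ^ 3 * B := by
        field_simp
        ring
    _ = ∑ i ∈ s, (3 * (A / B) ^ 2 * a i - 2 * (A / B) ^ 3 * b i) := by
        rw [Finset.sum_sub_distrib, ← Finset.mul_sum, ← Finset.mul_sum]
    _ ≤ _ := Finset.sum_le_sum fun i hi => ?_
  have hbi := hb i hi
  have hx : 0 ≤ a i / b i := div_nonneg (ha i hi) hbi.le
  have h : a i ^ 3 / b i ^ 2 - (3 * (A / B) ^ 2 * a i - 2 * (A / B) ^ 3 * b i)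
      = b i * ((a i / b i - A / B) ^ 2 * (a i / b i + 2 * (A / B))) := by
    field_simp
    ring
  have h0 : 0 ≤ b i * ((a i / b i - A / B) ^ 2 * (a i / b i + 2 * (A / B))) := by positivity
  linarith

namespace MetrizedGraph

variable {V E : Type*} {Γ : MetrizedGraph V E}

lemma Parallel.symm {e e' : E} (h : Γ.Parallel e e') : Γ.Parallel e' e := by
  unfold Parallel at *
  grind

lemma Parallel.trans {e e' e'' : E} (h : Γ.Parallel e e') (h' : Γ.Parallel e' e'') :
    Γ.Parallel e e'' := by
  unfold Parallel at *
  grind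

/-- The ends coincide, so the resistance between them is zero and the density is 1/L. -/
lemma le_edgeDensity_of_loop (G : V → V → ℝ) {e : E} (h : Γ.src e = Γ.tgt e) {ρ : ℝ} (hρ : 0 ≤ ρ) :
    (Γ.len e + ρ)⁻¹ ≤ Γ.edgeDensity G e := by
  have : Γ.edgeDensity G e = (Γ.len e)⁻¹ := by
    rw [edgeDensity, h]
    ring
  rw [this]
  exact inv_anti₀ (Γ.len_pos e) (by linarith)

open Classical in
lemma IsGreen.laplacian_sub [Fintype E] {o : V} {G : V → V → ℝ} (hG : Γ.IsGreen o G) (v w x : V) : Γ.laplacian (fun x => G v x - G w x) x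
    = (if x = v then 1 else 0) - (if x = w then 1 else 0) := by
  have h1 := Γ.laplacian_add (G v) (fun x => -1 * G w x) x
  rw [laplacian_const_mul, hG.laplacian, hG.laplacian] at h1
  have h2 : (fun x => G v x - G w x) = fun x => G v x + -1 * G w x := by
    ext
    ring
  rw [h2, h1]
  ring

variable [Fintype V] [Fintype E] {o : V} {G : V → V → ℝ}

lemma Connected.exists_green (hΓ : Γ.Connected) : ∃ o G, Γ.IsGreen o G :=
  ⟨hΓ.nonempty.some, hΓ.exists_isGreen _⟩

theorem Connected.existsUnique_isTauConstant (hΓ : Γ.Connected) : ∃! t, Γ.IsTauConstant t := by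
  obtain ⟨o, G, hG⟩ := hΓ.exists_green
  exact ⟨_, (hG.isTauConstant_iff hΓ _).2 rfl, fun t ht => (hG.isTauConstant_iff hΓ t).1 ht⟩

theorem IsGreen.tau_eq (hG : Γ.IsGreen o G) (hΓ : Γ.Connected) :
    Γ.tau = 1 / 4 * ∑ e, (G (Γ.src e) (Γ.src e) - G (Γ.tgt e) (Γ.tgt e)) ^ 2 / Γ.len e
        + 1 / 12 * ∑ e, Γ.edgeDensity G e ^ 2 * Γ.len e ^ 3 := by
  have h : Γ.IsTauConstant Γ.tau := Classical.epsilon_spec hΓ.existsUnique_isTauConstant.exists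
  rw [(hG.isTauConstant_iff hΓ _).1 h, hG.canonicalIntegral_green_self]
  ring

lemma IsGreen.le_tau (hG : Γ.IsGreen o G) (hΓ : Γ.Connected) :
    1 / 12 * ∑ e, Γ.edgeDensity G e ^ 2 * Γ.len e ^ 3 ≤ Γ.tau := by
  rw [hG.tau_eq hΓ]
  have : 0 ≤ ∑ e, (G (Γ.src e) (Γ.src e) - G (Γ.tgt e) (Γ.tgt e)) ^ 2 / Γ.len e :=
    Finset.sum_nonneg fun e _ => div_nonneg (sq_nonneg _) (Γ.len_pos e).le
  linarith

lemma Connected.tau_nonneg (hΓ : Γ.Connected) : 0 ≤ Γ.tau := by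
  obtain ⟨o, G, hG⟩ := hΓ.exists_green
  refine le_trans ?_ (hG.le_tau hΓ)
  have : 0 ≤ ∑ e, Γ.edgeDensity G e ^ 2 * Γ.len e ^ 3 := Finset.sum_nonneg fun e _ =>
    mul_nonneg (sq_nonneg _) (pow_nonneg (Γ.len_pos e).le 3)
  linarith

lemma IsGreen.le_tau_of_le_edgeDensity (hG : Γ.IsGreen o G) (hΓ : Γ.Connected) {ρ : E → ℝ}
    (hρ : ∀ e, 0 ≤ ρ e) (h : ∀ e, (Γ.len e + ρ e)⁻¹ ≤ Γ.edgeDensity G e) :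
    1 / 12 * (Γ.totalLength ^ 3 / (Γ.totalLength + ∑ e, ρ e) ^ 2) ≤ Γ.tau := by
  have hb : ∀ e, 0 < Γ.len e + ρ e := fun e => add_pos_of_pos_of_nonneg (Γ.len_pos e) (hρ e)
  refine le_trans ?_ (hG.le_tau hΓ)
  refine mul_le_mul_of_nonneg_left ?_ (by norm_num)
  rw [totalLength, ← Finset.sum_add_distrib]
  refine (sum_pow_three_div_sq_le _ (fun e _ => (Γ.len_pos e).le) fun e _ => hb e).trans ?_
  refine Finset.sum_le_sum fun e _ => ?_
  rw [div_eq_inv_mul, ← inv_pow]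
  exact mul_le_mul_of_nonneg_right (pow_le_pow_left₀ (inv_nonneg.2 (hb e).le) (h e) 2)
    (pow_nonneg (Γ.len_pos e).le 3)

/-- The effective resistance between two vertices in terms of a Green function. -/
noncomputable def vertexResistance (G : V → V → ℝ) (v w : V) : ℝ :=
  G v v - 2 * G v w + G w w

namespace IsGreen

variable (hG : Γ.IsGreen o G)
include hG

lemma resistance_vertex (hΓ : Γ.Connected) (v w : V) :
    Γ.resistance (.vertex v) (.vertex w) = vertexResistance G v w := by
  rw [resistance, hG.voltage_self hΓ]
  simp only [green, tent_vertex_left, interp_vertex, vertexResistance]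
  ring

lemma sub_eq_vertexResistance (v w : V) :
    (G v v - G w v) - (G v w - G w w) = vertexResistance G v w := by
  rw [hG.symm w v, vertexResistance]
  ring

lemma vertexResistance_eq_sum (v w : V) : vertexResistance G v w
    = ∑ e, ((G v (Γ.src e) - G w (Γ.src e)) - (G v (Γ.tgt e) - G w (Γ.tgt e))) ^ 2 / Γ.len e := by
  classical
  have h := Γ.sum_mul_laplacian (fun x => G v x - G w x) (fun x => G v x - G w x)
  simp only [hG.laplacian_sub, mul_sub, mul_ite, mul_one, mul_zero, Finset.sum_sub_distrib,
    Finset.sum_ite_eq', Finset.mem_univ, if_true] at h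
  rw [← hG.sub_eq_vertexResistance, h]
  exact Finset.sum_congr rfl fun e _ => by ring

lemma vertexResistance_nonneg (v w : V) : 0 ≤ vertexResistance G v w := by
  rw [hG.vertexResistance_eq_sum]
  exact Finset.sum_nonneg fun e _ => div_nonneg (sq_nonneg _) (Γ.len_pos e).le

open Classical in
/-- If the current `c` entering at `v` and exiting at `w` produces the potential `f`, then Ohm's
law holds for `f`. -/
lemma mul_vertexResistance_eq {f : V → ℝ} {c : ℝ} {v w : V}
    (hf : ∀ x, Γ.laplacian f x = c * ((if x = v then 1 else 0) - (if x = w then 1 else 0))) :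
    c * vertexResistance G v w = f v - f w := by
  have h1 := hG.sum_mul_laplacian f v
  have h2 := hG.sum_mul_laplacian f w
  simp only [hf, mul_sub, mul_ite, mul_one, mul_zero, Finset.sum_sub_distrib,
    Finset.sum_ite_eq', Finset.mem_univ, if_true] at h1 h2
  rw [← hG.sub_eq_vertexResistance]
  linarith

/-- Take the potential of a unit current through Γ - e, with voltage drop R between the ends of e.
Putting e back draws an additional current R/L, so the same potential belongs to the current 1 + R/L
in Γ. Ohm's law gives r = RL/(L + R). -/
lemma edgeDensity_eq_inv {e : E} [Fintype {e' : E // e' ≠ e}] {o' : V} {G' : V → V → ℝ}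
    (hG' : (Γ.deleteEdge e).IsGreen o' G') :
    Γ.edgeDensity G e = (Γ.len e + vertexResistance G' (Γ.src e) (Γ.tgt e))⁻¹ := by
  classical
  set R := vertexResistance G' (Γ.src e) (Γ.tgt e) with hR
  have hR0 : 0 ≤ R := hG'.vertexResistance_nonneg _ _
  have hL := Γ.len_pos e
  have hsub := hG'.sub_eq_vertexResistance (Γ.src e) (Γ.tgt e)
  rw [← hR] at hsub
  have hlap : ∀ x, Γ.laplacian (fun x => G' (Γ.src e) x - G' (Γ.tgt e) x) x
      = (1 + R / Γ.len e)
        * ((if x = Γ.src e then 1 else 0) - (if x = Γ.tgt e then 1 else 0)) := by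
    intro x
    have h1 := hG'.laplacian_sub (Γ.src e) (Γ.tgt e) x
    have h2 : Γ.laplacian (fun x => G' (Γ.src e) x - G' (Γ.tgt e) x) x
        = R / Γ.len e * ((if x = Γ.src e then 1 else 0) - (if x = Γ.tgt e then 1 else 0))
          + (Γ.deleteEdge e).laplacian (fun x => G' (Γ.src e) x - G' (Γ.tgt e) x) x := by
      rw [MetrizedGraph.laplacian, Fintype.sum_eq_add_sum_subtype_ne _ e]
      congr 1
      · simp only [eq_comm (a := x)]
        rw [hsub, ← neg_sub, hsub]
        split_ifs <;> ring
      · simp only [MetrizedGraph.laplacian, deleteEdge]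
        congr! 1
        ext
        simp
    rw [h2, h1]
    ring
  have h := hG.mul_vertexResistance_eq hlap
  have hr : edgeDensity Γ G e = (1 - vertexResistance G (Γ.src e) (Γ.tgt e) / Γ.len e) / Γ.len e :=
    rfl
  have h' : vertexResistance G (Γ.src e) (Γ.tgt e) = R * Γ.len e / (Γ.len e + R) := by
    rw [eq_div_iff (by positivity)]
    have : (G' (Γ.src e) (Γ.src e) - G' (Γ.tgt e) (Γ.src e))
        - (G' (Γ.src e) (Γ.tgt e) - G' (Γ.tgt e) (Γ.tgt e)) = R := hsub
    rw [this] at h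
    field_simp at h
    linarith
  rw [hr, h']
  field_simp
  ring

/-- The energy of the unit current equals r, and the two parallel edges alone dissipate r²/L +
r²/L'. Hence r ≤ LL'/(L + L'), which bounds the density without passing to Γ - e. -/
lemma le_edgeDensity_of_parallel {e e' : E} (hne : e' ≠ e) (h : Γ.Parallel e e') :
    (Γ.len e + Γ.len e')⁻¹ ≤ Γ.edgeDensity G e := by
  classical
  set r := vertexResistance G (Γ.src e) (Γ.tgt e) with hr
  have hL := Γ.len_pos e
  have hL' := Γ.len_pos e'
  have hr0 : 0 ≤ r := hG.vertexResistance_nonneg _ _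
  have hsub := hG.sub_eq_vertexResistance (Γ.src e) (Γ.tgt e)
  rw [← hr] at hsub
  have hle : r ^ 2 / Γ.len e + r ^ 2 / Γ.len e' ≤ r := by
    have h1 := hG.vertexResistance_eq_sum (Γ.src e) (Γ.tgt e)
    rw [← hr] at h1
    conv_rhs => rw [h1]
    have h2 := Finset.sum_le_sum_of_subset_of_nonneg (Finset.subset_univ ({e, e'} : Finset E))
      (f := fun i => ((G (Γ.src e) (Γ.src i) - G (Γ.tgt e) (Γ.src i))
        - (G (Γ.src e) (Γ.tgt i) - G (Γ.tgt e) (Γ.tgt i))) ^ 2 / Γ.len i)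
      fun i _ _ => div_nonneg (sq_nonneg _) (Γ.len_pos i).le
    rw [Finset.sum_pair hne.symm, hsub] at h2
    refine le_trans (le_of_eq ?_) h2
    rcases h with ⟨h3, h4⟩ | ⟨h3, h4⟩
    · rw [h3, h4, hsub]
    · rw [h3, h4, ← neg_sub, hsub, neg_sq]
  have hrle : r * (Γ.len e + Γ.len e') ≤ Γ.len e * Γ.len e' := by
    rcases hr0.eq_or_lt with h0 | h0
    · rw [← h0]
      nlinarith [mul_pos hL hL']
    · have h5 : r ^ 2 / Γ.len e + r ^ 2 / Γ.len e'
          = r * (r * (Γ.len e + Γ.len e')) / (Γ.len e * Γ.len e') := by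
        field_simp
        ring
      rw [h5, div_le_iff₀ (mul_pos hL hL')] at hle
      exact le_of_mul_le_mul_left hle h0
  have h6 : Γ.edgeDensity G e = (1 - r / Γ.len e) / Γ.len e := rfl
  rw [h6, le_div_iff₀ hL, ← sub_nonneg]
  have h7 : 1 - r / Γ.len e - (Γ.len e + Γ.len e')⁻¹ * Γ.len e
      = (Γ.len e * Γ.len e' - r * (Γ.len e + Γ.len e')) / (Γ.len e * (Γ.len e + Γ.len e')) := by
    field_simp
    ring
  rw [h7]
  exact div_nonneg (sub_nonneg.2 hrle) (by positivity)

end IsGreen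

theorem Connected.le_tau_of_totalLength_eq_one (hΓ : Γ.Connected) (hℓ : Γ.totalLength = 1) :
    (((12 * (1 + ∑ e, Γ.deletedResistance e) ^ 2)⁻¹ : ℝ≥0∞) : EReal) ≤ ((Γ.tau : ℝ) : EReal) := by
  classical
  -- An infinite resistance makes the left-hand side zero, and nonnegativity of τ suffices.
  by_cases htop : ∃ e, Γ.deletedResistance e = ⊤
  · obtain ⟨e, he⟩ := htop
    have : ∑ e, Γ.deletedResistance e = ⊤ := ENNReal.sum_eq_top.2 ⟨e, Finset.mem_univ e, he⟩
    rw [this]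
    simpa using hΓ.tau_nonneg
  push Not at htop
  have hconn : ∀ e, (Γ.deleteEdge e).Connected := fun e => by
    by_contra h
    exact htop e (if_neg h)
  choose o' G' hG' using fun e => (hconn e).exists_green
  obtain ⟨o, G, hG⟩ := hΓ.exists_green
  set R : E → ℝ := fun e => vertexResistance (G' e) (Γ.src e) (Γ.tgt e) with hR
  have hR0 : ∀ e, 0 ≤ R e := fun e => (hG' e).vertexResistance_nonneg _ _
  have hdel : ∀ e, Γ.deletedResistance e = ENNReal.ofReal (R e) := fun e => by
    rw [deletedResistance, if_pos (hconn e)]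
    congr 1
    convert (hG' e).resistance_vertex (hconn e) (Γ.src e) (Γ.tgt e)
  have hmain := hG.le_tau_of_le_edgeDensity hΓ hR0 fun e => (hG.edgeDensity_eq_inv (hG' e)).ge
  have hS : 0 ≤ ∑ e, R e := Finset.sum_nonneg fun e _ => hR0 e
  have hcast : (12 * (1 + ∑ e, Γ.deletedResistance e) ^ 2)⁻¹
      = ENNReal.ofReal ((12 * (1 + ∑ e, R e) ^ 2)⁻¹) := by
    simp only [hdel]
    rw [← ENNReal.ofReal_sum_of_nonneg fun e _ => hR0 e, ENNReal.ofReal_inv_of_pos (by positivity),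
      ENNReal.ofReal_mul (by norm_num), ENNReal.ofReal_pow (by positivity),
      ENNReal.ofReal_add zero_le_one hS]
    simp
  rw [hcast, EReal.coe_ennreal_ofReal, max_eq_left (by positivity), EReal.coe_le_coe_iff]
  rw [hℓ] at hmain
  refine le_trans (le_of_eq ?_) hmain
  field_simp

theorem Connected.le_tau_of_adjacentMultiplyJoined (hΓ : Γ.Connected)
    (h : Γ.AdjacentMultiplyJoined) : 1 / 48 * Γ.totalLength ≤ Γ.tau := by
  classical
  obtain ⟨o, G, hG⟩ := hΓ.exists_green
  set S : E → Finset E := fun e => Finset.univ.filter fun e' => e' ≠ e ∧ Γ.Parallel e e' with hS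
  have hmem : ∀ e e', e' ∈ S e ↔ e' ≠ e ∧ Γ.Parallel e e' := fun e e' => by simp [hS]
  -- All edges of a parallel class have the same number of companions; this makes the double
  -- counting of `hsum` exact on each class.
  have hcard : ∀ e e', e' ∈ S e → (S e').card = (S e).card := by
    intro e e' he
    have hpar := ((hmem e e').1 he).2
    have h1 : e ∈ S e' := (hmem e' e).2 ⟨((hmem e e').1 he).1.symm, hpar.symm⟩
    have h2 : (S e').erase e = (S e).erase e' := by
      ext e''
      simp only [Finset.mem_erase, hmem]
      exact ⟨fun ⟨a, b, c⟩ => ⟨b, a, hpar.trans c⟩, fun ⟨a, b, c⟩ => ⟨b, a, hpar.symm.trans c⟩⟩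
    rw [← Finset.card_erase_add_one h1, h2, Finset.card_erase_add_one he]
  -- The mean length of the companions of `e`. For a self-loop without companions this is 0/0 = 0,
  -- which is harmless.
  set ρ : E → ℝ := fun e => (∑ e' ∈ S e, Γ.len e') / (S e).card with hρ
  have hρ0 : ∀ e, 0 ≤ ρ e := fun e =>
    div_nonneg (Finset.sum_nonneg fun e' _ => (Γ.len_pos e').le) (Nat.cast_nonneg _)
  have hdens : ∀ e, (Γ.len e + ρ e)⁻¹ ≤ Γ.edgeDensity G e := by
    intro e
    by_cases hloop : Γ.src e = Γ.tgt e
    · exact le_edgeDensity_of_loop G hloop (hρ0 e)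
    obtain ⟨e₁, he₁⟩ := h e hloop
    have hne : (S e).Nonempty := ⟨e₁, (hmem e e₁).2 he₁⟩
    have hn : (0 : ℝ) < (S e).card := by exact_mod_cast hne.card_pos
    -- Some companion is at most as long as the mean.
    obtain ⟨e', he', hle⟩ := Finset.exists_le_of_sum_le (f := Γ.len) (g := fun _ => ρ e) hne (by
      rw [Finset.sum_const, nsmul_eq_mul]
      exact (mul_div_cancel₀ _ hn.ne').ge)
    obtain ⟨hne', hpar⟩ := (hmem e e').1 he'
    refine le_trans ?_ (hG.le_edgeDensity_of_parallel hne' hpar)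
    exact inv_anti₀ (add_pos (Γ.len_pos e) (Γ.len_pos e')) (by linarith)
  have hsum : ∑ e, ρ e ≤ Γ.totalLength := by
    -- Dividing by the cardinality for `e'` instead of `e` lets the swapped sum count `len e'` with
    -- weight 1/|S e'| exactly |S e'| times.
    have h1 : ∀ e, ρ e = ∑ e', if e' ∈ S e then Γ.len e' / (S e').card else 0 := fun e => by
      rw [← Finset.sum_filter, Finset.filter_mem_eq_inter, Finset.univ_inter, hρ]
      simp only [Finset.sum_div]
      exact Finset.sum_congr rfl fun e' he' => by rw [hcard e e' he']
    have hsymm : ∀ e e', e' ∈ S e ↔ e ∈ S e' := fun e e' => by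
      rw [hmem, hmem]
      exact ⟨fun ⟨a, b⟩ => ⟨a.symm, b.symm⟩, fun ⟨a, b⟩ => ⟨a.symm, b.symm⟩⟩
    simp only [h1]
    rw [Finset.sum_comm]
    refine Finset.sum_le_sum fun e' _ => ?_
    simp only [fun e => hsymm e e']
    rw [← Finset.sum_filter, Finset.filter_mem_eq_inter, Finset.univ_inter, Finset.sum_const,
      nsmul_eq_mul]
    rcases eq_or_ne ((S e').card : ℝ) 0 with h0 | h0
    · rw [h0, zero_mul]
      exact (Γ.len_pos e').le
    · rw [mul_div_cancel₀ _ h0]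
  have hℓ : 0 ≤ Γ.totalLength := Finset.sum_nonneg fun e _ => (Γ.len_pos e).le
  -- Total length zero, the graph without edges, is separated because the final computation divides
  -- by ℓ.
  rcases hℓ.eq_or_lt with h0 | h0
  · rw [← h0, mul_zero]
    exact hΓ.tau_nonneg
  refine le_trans ?_ (hG.le_tau_of_le_edgeDensity hΓ hρ0 hdens)
  have hρs : 0 ≤ ∑ e, ρ e := Finset.sum_nonneg fun e _ => hρ0 e
  calc 1 / 48 * Γ.totalLength
      = 1 / 12 * (Γ.totalLength ^ 3 / (Γ.totalLength + Γ.totalLength) ^ 2) := by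
        field_simp
        norm_num
    _ ≤ _ := by gcongr

end MetrizedGraph

theorem mainTheorem7 {V E : Type*} [Fintype V] [Fintype E] (Γ : MetrizedGraph V E)
    (hΓ : Γ.Connected) :
    -- the tau constant is well defined
    (∃! t : ℝ, Γ.IsTauConstant t) ∧
    -- the general lower bound; its right-hand side is `0` if some `R_e` is infinite
    (Γ.totalLength = 1 →
      (((12 * (1 + ∑ e, Γ.deletedResistance e) ^ 2)⁻¹ : ℝ≥0∞) : EReal) ≤ ((Γ.tau : ℝ) : EReal)) ∧
    -- the case of multiple edges
    (Γ.totalLength = 1 → Γ.AdjacentMultiplyJoined → 1 / 48 ≤ Γ.tau) ∧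
    -- the lower bound conjecture for that class, for arbitrary total length
    (Γ.AdjacentMultiplyJoined → 1 / 48 * Γ.totalLength ≤ Γ.tau) := by
  refine ⟨hΓ.existsUnique_isTauConstant, hΓ.le_tau_of_totalLength_eq_one, fun hℓ h => ?_,
    hΓ.le_tau_of_adjacentMultiplyJoined⟩
  simpa only [hℓ, mul_one] using hΓ.le_tau_of_adjacentMultiplyJoined h
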